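/- **Setting.** Let $d\ge 1$, $r\ge 0$. Let $\alpha,\beta\in C^2([0,1])$ and $\epsilon\in C^0([0,1])$ satisfy $\alpha_0=\beta_1=1$, $\alpha_1=\beta_0=0$, $\alpha_t^2+\beta_t^2>0$ and $\epsilon_t\ge 0$ on $[0,1]$. Let $T\in(0,1]$ be such that $\alpha_t\neq 0$ for all $t\in[0,T)$. Let $\sigma:\mathbb R\to\mathbb R$ (applied coordinatewise), $p:[0,1]\to\mathbb R$ measurable, $b\in\mathbb R$, $w\in\mathbb R^{d\times r}$, $v\in\mathbb R^r$ be arbitrary; in the application $(b,w,v)=(b_\tau,w_\tau,v_\tau)$ are the parameters obtained at the end of training. Put $$f(t,x)=b\,x+\tfrac{w}{\sqrt d}\,\sigma\!\Big(\tfrac{w^\top x}{\sqrt d}+p_t v\Big),\qquad \mathcal Q=\tfrac{w^\top w}{d},$$ $$\Gamma_t=\dot\beta_t-\tfrac{\dot\alpha_t}{\alpha_t}\beta_t+\epsilon_t\tfrac{\beta_t}{\alpha_t^2},\qquad \Delta_t=b\,\Gamma_t+\tfrac{\dot\alpha_t}{\alpha_t}-\tfrac{\epsilon_t}{\alpha_t^2},$$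 let $\mathcal W\subset\mathbb R^d$ be the span of the columns of $w$, and let $\Pi$ and $\Pi^\perp$ be the orthogonal projections onto $\mathcal W$ and $\mathcal W^\perp$. Let $(X_t)_{t\in[0,T)}$ be a solution (continuous and adapted, on a filtered probability space carrying a $d$-dimensional Wiener process $W$ of that filtration) of $$dX_t=\Gamma_t f(t,X_t)\,dt+\Big(\tfrac{\dot\alpha_t}{\alpha_t}-\tfrac{\epsilon_t}{\alpha_t^2}\Big)X_t\,dt+\sqrt{2\epsilon_t}\,dW_t,\qquad X_0\sim\mathcal N(0,I_d),$$ and set $Z_t=w^\top X_t/\sqrt d\in\mathbb R^r$ and $Y_t=\Pi^\perp X_t$. **Claim.** 1. $Z_0\sim\mathcal N(0,\mathcal Q)$, and $Z$ solves on $[0,T)$ the closed $r$-dimensional SDE $$dZ_t=\Delta_t Z_t\,dt+\Gamma_t\,\mathcal Q\,\sigma(Z_t+p_t v)\,dt+\sqrt{2\epsilon_t}\,\mathcal Q^{1/2}\,dB_t \qquad (\ast)$$ with an $r$-dimensional Wiener process $B$, defined in general on an extension of the probability space by an independent factor; if the columns of $w$ are linearly independent, $B$ can be taken on the original space and to be a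 Wiener process of the original filtration. 2. For every $t\in[0,T)$, $$Y_t\sim\mathcal N\Big(0,\;e^{2\int_0^t\Delta_s ds}\Big[1+2\int_0^t e^{-2\int_0^s\Delta_h dh}\,\epsilon_s\,ds\Big]\,\Pi^\perp\Big).$$ 3. Suppose that $z\mapsto\sigma(z+p_tv)$ is locally Lipschitz in $z$, uniformly for $t$ in compact subintervals of $[0,T)$ (for instance $\sigma$ Lipschitz, or $\sigma$ locally Lipschitz and $p$ bounded). Then the processes $(Y_t)_{t\in[0,T)}$ and $(Z_t)_{t\in[0,T)}$ are independent; in particular $Y_t$ is independent of $Z_t$ for every $t$. 4. There is a linear map $L:\mathbb R^r\to\mathbb R^d$ with $L(w^\top x/\sqrt d)=\Pi x$ for all $x\in\mathbb R^d$, such that, under the assumption of 3, the law of $X_t$ is, for every $t\in[0,T)$, the convolution of the law of $L Z'_t$ with the Gaussian law in 2, where $Z'$ is any solution of $(\ast)$ on $[0,T)$, on any filtered probability space, with $Z'_0\sim\mathcal N(0,\mathcal Q)$. Thus $(\ast)$ and 2 fully describe the law of $X_t$. -/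

import Mathlib

open MeasureTheory ProbabilityTheory Filter Set
open scoped NNReal ENNReal MatrixOrder

universe u v

namespace GenDyn

/-- `ℝⁿ` with its Euclidean structure. -/
abbrev E (n : ℕ) : Type := EuclideanSpace ℝ (Fin n)

/-! ### Stochastic calculus: Wiener processes, integrals of deterministic integrands, SDEs -/

/-- `B` is a standard `n`-dimensional Wiener process relative to the filtration `𝓕`. -/
structure IsWienerProcess {Ω : Type u} {mΩ : MeasurableSpace Ω} {n : ℕ}
    (P : Measure Ω) (𝓕 : Filtration ℝ≥0 mΩ) (B : ℝ≥0 → Ω → E n) : Prop where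
  adapted : ∀ t, Measurable[𝓕 t] (B t)
  start_zero : ∀ᵐ ω ∂P, B 0 ω = 0
  continuous_paths : ∀ᵐ ω ∂P, Continuous fun t => B t ω
  increment_law : ∀ s t : ℝ≥0, s ≤ t →
    HasLaw (fun ω => B t ω - B s ω)
      (multivariateGaussian 0 (((t : ℝ) - s) • (1 : Matrix (Fin n) (Fin n) ℝ))) P
  increment_indep : ∀ s t : ℝ≥0, s ≤ t →
    Indep (𝓕 s) (MeasurableSpace.comap (fun ω => B t ω - B s ω) inferInstance) P

/-- The left-endpoint Riemann sum `∑ₖ G(sₖ) (B(sₖ₊₁) - B(sₖ))` over the subdivision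
`sₖ = k t / N` of `[0, t]` into `N` equal pieces. -/
noncomputable def itoSum {Ω : Type u} {m n : ℕ} (G : ℝ → Matrix (Fin m) (Fin n) ℝ)
    (B : ℝ≥0 → Ω → E n) (t : ℝ≥0) (N : ℕ) (ω : Ω) : E m :=
  ∑ k ∈ Finset.range N,
    Matrix.toEuclideanLin (G ((k : ℝ) * t / N))
      (B (((k : ℝ≥0) + 1) * t / N) ω - B ((k : ℝ≥0) * t / N) ω)

/-- The random variable `I` is the Itô integral `∫₀ᵗ G(s) dB_s` of the deterministic matrix-valued
integrand `G`. This is used for `G` continuous on `[0, t]` only; for such `G` the Riemann sums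
converge in probability, and their limit (unique up to null sets) is the Itô integral. -/
def IsItoIntegral {Ω : Type u} {mΩ : MeasurableSpace Ω} {m n : ℕ} (P : Measure Ω)
    (G : ℝ → Matrix (Fin m) (Fin n) ℝ) (B : ℝ≥0 → Ω → E n) (t : ℝ≥0) (I : Ω → E m) : Prop :=
  TendstoInMeasure P (itoSum G B t) atTop I

/-- `X` is a solution on the time interval `[0, T)` of `dX = drift(t, X) dt + G(t) dB`, on the
probability space `(Ω, P)` with filtration `𝓕`, where `B` is an `𝓕`-Wiener process. Values of `X` at
times `t ≥ T` are irrelevant. -/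
structure IsSDESolution {Ω : Type u} {mΩ : MeasurableSpace Ω} {m n : ℕ}
    (P : Measure Ω) (𝓕 : Filtration ℝ≥0 mΩ) (T : ℝ)
    (drift : ℝ → E m → E m) (G : ℝ → Matrix (Fin m) (Fin n) ℝ)
    (B : ℝ≥0 → Ω → E n) (X : ℝ≥0 → Ω → E m) : Prop where
  wiener : IsWienerProcess P 𝓕 B
  adapted : ∀ t : ℝ≥0, (t : ℝ) < T → Measurable[𝓕 t] (X t)
  continuous_paths : ∀ᵐ ω ∂P, ContinuousOn (fun t => X t ω) {t : ℝ≥0 | (t : ℝ) < T}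
  drift_integrable : ∀ᵐ ω ∂P, ∀ t : ℝ≥0, (t : ℝ) < T →
    IntervalIntegrable (fun s => drift s (X s.toNNReal ω)) volume 0 t
  equation : ∀ t : ℝ≥0, (t : ℝ) < T →
    IsItoIntegral P G B t
      (fun ω => X t ω - X 0 ω - ∫ s in (0 : ℝ)..t, drift s (X s.toNNReal ω))

/-! ### The generative model -/

/-- The standing assumptions on the interpolants `α, β` and the diffusion schedule `ε`. -/
structure IsSchedule (α β ε : ℝ → ℝ) : Prop where
  α_C2 : ContDiffOn ℝ 2 α (Icc 0 1)
  β_C2 : ContDiffOn ℝ 2 β (Icc 0 1)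
  ε_C0 : ContinuousOn ε (Icc 0 1)
  α_zero : α 0 = 1
  α_one : α 1 = 0
  β_zero : β 0 = 0
  β_one : β 1 = 1
  pos : ∀ t ∈ Icc (0 : ℝ) 1, 0 < α t ^ 2 + β t ^ 2
  ε_nonneg : ∀ t ∈ Icc (0 : ℝ) 1, 0 ≤ ε t

/-- Time derivative of a schedule function on `[0, 1]`. -/
noncomputable def dot (f : ℝ → ℝ) (t : ℝ) : ℝ := derivWithin f (Icc 0 1) t

/-- `Γ_t = β̇_t - (α̇_t / α_t) β_t + ε_t β_t / α_t²`. -/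
noncomputable def Gam (α β ε : ℝ → ℝ) (t : ℝ) : ℝ :=
  dot β t - dot α t / α t * β t + ε t * (β t / α t ^ 2)

/-- `Δ_t = b Γ_t + α̇_t / α_t - ε_t / α_t²`. -/
noncomputable def Del (α β ε : ℝ → ℝ) (b : ℝ) (t : ℝ) : ℝ :=
  b * Gam α β ε t + dot α t / α t - ε t / α t ^ 2

/-- The hidden projection `wᵀ x / √d`. -/
noncomputable def hiddenProj {d r : ℕ} (w : Matrix (Fin d) (Fin r) ℝ) (x : E d) : E r :=
  (√(d : ℝ))⁻¹ • Matrix.toEuclideanLin w.transpose x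

/-- The activation, applied coordinatewise to the shifted preactivation: `σ(z + p_t v)`. -/
def act {r : ℕ} (σ p : ℝ → ℝ) (v : E r) (t : ℝ) (z : E r) : E r :=
  WithLp.toLp 2 fun j => σ (z j + p t * v j)

/-- The tied-weight denoising autoencoder `b x + (w / √d) σ(wᵀ x / √d + p_t v)`. -/
noncomputable def dae {d r : ℕ} (σ p : ℝ → ℝ) (b : ℝ) (w : Matrix (Fin d) (Fin r) ℝ) (v : E r)
    (t : ℝ) (x : E d) : E d :=
  b • x + (√(d : ℝ))⁻¹ • Matrix.toEuclideanLin w (act σ p v t (hiddenProj w x))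

/-- Drift of the learned generative SDE. -/
noncomputable def genDrift {d r : ℕ} (α β ε σ p : ℝ → ℝ) (b : ℝ) (w : Matrix (Fin d) (Fin r) ℝ)
    (v : E r) (t : ℝ) (x : E d) : E d :=
  (dot β t - dot α t / α t * β t + ε t * (β t / α t ^ 2)) • dae σ p b w v t x
    + (dot α t / α t - ε t / α t ^ 2) • x

/-- Diffusion matrix of the learned generative SDE, `√(2 ε_t) I_d`. -/
noncomputable def genDiffusion (d : ℕ) (ε : ℝ → ℝ) (t : ℝ) : Matrix (Fin d) (Fin d) ℝ :=
  √(2 * ε t) • (1 : Matrix (Fin d) (Fin d) ℝ)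

/-- The summary statistic `𝒬 = wᵀ w / d`. -/
noncomputable def overlap {d r : ℕ} (w : Matrix (Fin d) (Fin r) ℝ) : Matrix (Fin r) (Fin r) ℝ :=
  (d : ℝ)⁻¹ • (w.transpose * w)

/-- Drift of the low-dimensional SDE, `Δ_t z + Γ_t 𝒬 σ(z + p_t v)`. -/
noncomputable def lowDrift {r : ℕ} (α β ε σ p : ℝ → ℝ) (b : ℝ) (Q : Matrix (Fin r) (Fin r) ℝ)
    (v : E r) (t : ℝ) (z : E r) : E r :=
  Del α β ε b t • z + Gam α β ε t • Matrix.toEuclideanLin Q (act σ p v t z)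

/-- Diffusion matrix of the low-dimensional SDE, `√(2 ε_t) 𝒬^{1/2}`. -/
noncomputable def lowDiffusion {r : ℕ} (ε : ℝ → ℝ) (Q : Matrix (Fin r) (Fin r) ℝ) (t : ℝ) :
    Matrix (Fin r) (Fin r) ℝ :=
  √(2 * ε t) • CFC.sqrt Q

/-- The column space of `w`. -/
def colSpace {d r : ℕ} (w : Matrix (Fin d) (Fin r) ℝ) : Submodule ℝ (E d) :=
  Submodule.span ℝ (range fun j => (WithLp.toLp 2 (w.col j) : E d))

/-- The orthogonal projection of `ℝᵈ` onto the orthogonal complement of the column space of `w`. -/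
noncomputable def perp {d r : ℕ} (w : Matrix (Fin d) (Fin r) ℝ) : E d →L[ℝ] E d :=
  (colSpace w)ᗮ.starProjection

/-- `e^{2 ∫₀ᵗ Δ_s ds} [1 + 2 ∫₀ᵗ e^{-2 ∫₀ˢ Δ_h dh} ε_s ds]`. -/
noncomputable def perpVariance (α β ε : ℝ → ℝ) (b : ℝ) (t : ℝ) : ℝ :=
  Real.exp (2 * ∫ s in (0 : ℝ)..t, Del α β ε b s) *
    (1 + 2 * ∫ s in (0 : ℝ)..t, Real.exp (-2 * ∫ h in (0 : ℝ)..s, Del α β ε b h) * ε s)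

/-- The centred Gaussian law on `ℝᵈ` whose covariance is `perpVariance · Π^⊥`. -/
noncomputable def perpLaw {d r : ℕ} (α β ε : ℝ → ℝ) (b : ℝ) (w : Matrix (Fin d) (Fin r) ℝ)
    (t : ℝ) : Measure (E d) :=
  multivariateGaussian 0
    (perpVariance α β ε b t • (Matrix.toEuclideanCLM (n := Fin d) (𝕜 := ℝ)).symm (perp w))

/-- `z ↦ σ(z + p_t v)` is locally Lipschitz in `z`, uniformly for `t` in compact subintervals
of `[0, T)`. It holds when `σ` is Lipschitz, and when `σ` is locally Lipschitz and `p` bounded. -/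
def LocLipActivation {r : ℕ} (T : ℝ) (σ p : ℝ → ℝ) (v : E r) : Prop :=
  ∀ R t : ℝ, t < T → ∃ K : ℝ≥0, ∀ s ∈ Icc 0 t, ∀ j,
    LipschitzOnWith K (fun x => σ (x + p s * v j)) (Icc (-R) R)

end GenDyn

open GenDyn

namespace GenDyn

open scoped Topology RealInnerProductSpace

/-! ### Riemann sums over equal subdivisions -/

section Blocks

/-! Subtracting from a solution its integrated drift leaves the initial value plus a Wiener integral
(`noisePart`). The integrand is a scalar `√(2ε)` times a constant matrix `S`, so this process starts
from a centred Gaussian and has independent Gaussian increments. Its law is governed by `ε` and the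
single form `q u = ‖Sᵀ u‖²`, since the initial covariance is `S Sᵀ` both for `X` (`S = 1`) and for
`Z` (`S = 𝒬^{1/2}`). `IsSDESolution.gaussianIncrements` proves this from the Riemann sums that
define the integral.

The nonlinear term of the drift takes values in the column space of `w` and depends on `x` only
through `wᵀx/√d`. Hence `Π^⊥` turns the drift into the linear one `Δ Y` (`perp_genDrift`), and
`wᵀ/√d` turns it into a function of `Z` alone (`hiddenCLM_genDrift`). The equation for `Y` is solved
by variation of constants, which gives its Gaussian law
(`GaussianIncrements.integral_exp_of_linear`). For `Z`, a polar decomposition `wᵀ/√d = 𝒬^{1/2} A`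
suggests `B = A W`. If `𝒬` is singular, `A` is only a partial isometry, and an independent Wiener
process fills the missing directions (`exists_polar_factor`, `IsWienerProcess.prod_add`).

Independence is clear for the noises of `Y` and `Z`: the adjoints of `Π^⊥` and `wᵀ/√d` have
orthogonal ranges, so `q = ‖·‖²` is additive across them and joint characteristic functions factor
(`GaussianIncrements.indepFun`). It passes to the processes without solving the nonlinear equation.
The map sending a continuous path to its noise at countably many times is continuous, and injective
by Grönwall, on a Polish space. By Lusin–Souslin it is a measurable embedding
(`measurableEmbedding_residual`), so a path and its noise generate the same σ-algebra. The same
embedding yields uniqueness in law for `(∗)`. Finally `X = L Z + Y` with independent summands, which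
is the convolution formula. -/

theorem block_subset {t : ℝ} (ht : 0 ≤ t) {M k : ℕ} (hk : k < M) :
    Icc ((k : ℝ) * t / M) (((k : ℝ) + 1) * t / M) ⊆ Icc 0 t := by
  have hM : (0 : ℝ) < M := by exact_mod_cast (Nat.zero_le k).trans_lt hk
  have hk' : (k : ℝ) + 1 ≤ M := by exact_mod_cast hk
  intro s hs
  refine ⟨le_trans (by positivity) hs.1, hs.2.trans ?_⟩
  rw [div_le_iff₀ hM, mul_comm t]
  exact mul_le_mul_of_nonneg_right hk' ht

theorem block_le {t : ℝ} (ht : 0 ≤ t) (M k : ℕ) :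
    (k : ℝ) * t / M ≤ ((k : ℝ) + 1) * t / M := by
  gcongr
  linarith

/-- The blocks have total length `t`, so a uniform bound `η` on the integrands bounds the sum by `η
t`. -/
theorem tendsto_sum_integral_blocks {F : Type*} [NormedAddCommGroup F] [NormedSpace ℝ F]
    {t : ℝ} (ht : 0 ≤ t) {φ : ℕ → ℕ → ℝ → F}
    (h : ∀ η > 0, ∀ᶠ M : ℕ in atTop, ∀ k < M,
      ∀ s ∈ Icc ((k : ℝ) * t / M) (((k : ℝ) + 1) * t / M), ‖φ M k s‖ ≤ η) :
    Tendsto (fun M : ℕ => ∑ k ∈ Finset.range M,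
      ∫ s in ((k : ℝ) * t / M)..(((k : ℝ) + 1) * t / M), φ M k s) atTop (𝓝 0) := by
  rw [Metric.tendsto_nhds]
  intro δ hδ
  -- Dividing by `t + 1` rather than `t` allows `t = 0` and makes the final inequality strict.
  filter_upwards [h (δ / (t + 1)) (by positivity), eventually_gt_atTop 0] with M hM hM0
  have hM0' : (0 : ℝ) < M := by exact_mod_cast hM0
  rw [dist_zero_right]
  calc ‖∑ k ∈ Finset.range M, ∫ s in ((k : ℝ) * t / M)..(((k : ℝ) + 1) * t / M), φ M k s‖
      ≤ ∑ k ∈ Finset.range M, δ / (t + 1) * (t / M) := by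
        refine norm_sum_le_of_le _ fun k hk => ?_
        have hb := block_le ht M k
        have := intervalIntegral.norm_integral_le_of_norm_le_const (C := δ / (t + 1))
          (f := φ M k) (a := (k : ℝ) * t / M) (b := ((k : ℝ) + 1) * t / M) (fun s hs => by
            rw [uIoc_of_le hb] at hs
            exact hM k (Finset.mem_range.1 hk) s (Ioc_subset_Icc_self hs))
        refine this.trans (le_of_eq ?_)
        rw [abs_of_nonneg (sub_nonneg.2 hb)]
        ring
    _ = δ * (t / (t + 1)) := by
        rw [Finset.sum_const, Finset.card_range, nsmul_eq_mul]
        field_simp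
    _ < δ := by
        have : t / (t + 1) < 1 := by rw [div_lt_one (by positivity)]; linarith
        nlinarith

theorem eventually_block_dist_le {F : Type*} [SeminormedAddCommGroup F] {t : ℝ} (ht : 0 ≤ t)
    {f : ℝ → F} (hf : ContinuousOn f (Icc 0 t)) {η : ℝ} (hη : 0 < η) :
    ∀ᶠ M : ℕ in atTop, ∀ k < M, ∀ s ∈ Icc ((k : ℝ) * t / M) (((k : ℝ) + 1) * t / M),
      ∀ s' ∈ Icc ((k : ℝ) * t / M) (((k : ℝ) + 1) * t / M), ‖f s - f s'‖ ≤ η := by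
  have hu := isCompact_Icc.uniformContinuousOn_of_continuous hf
  rw [Metric.uniformContinuousOn_iff] at hu
  obtain ⟨δ, hδ, H⟩ := hu η hη
  have hlim : Tendsto (fun M : ℕ => t / (M : ℝ)) atTop (𝓝 0) :=
    tendsto_const_div_atTop_nhds_zero_nat t
  filter_upwards [hlim.eventually (gt_mem_nhds hδ)] with M hM k hk s hs s' hs'
  rw [← dist_eq_norm]
  refine (H s (block_subset ht hk hs) s' (block_subset ht hk hs') ?_).le
  refine lt_of_le_of_lt (Real.dist_le_of_mem_Icc hs hs') ?_
  convert hM using 1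
  ring

theorem sum_integral_blocks {F : Type*} [NormedAddCommGroup F] [NormedSpace ℝ F]
    {t : ℝ} (ht : 0 ≤ t) {f : ℝ → F} (hf : IntervalIntegrable f volume 0 t) {M : ℕ} (hM : 0 < M) :
    ∑ k ∈ Finset.range M, ∫ s in ((k : ℝ) * t / M)..(((k : ℝ) + 1) * t / M), f s
      = ∫ s in 0..t, f s := by
  have hM' : (M : ℝ) ≠ 0 := by exact_mod_cast hM.ne'
  have := intervalIntegral.sum_integral_adjacent_intervals (f := f) (μ := volume)
    (a := fun k : ℕ => (k : ℝ) * t / M) (n := M) (fun k hk => by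
      refine hf.mono_set ?_
      push_cast
      rw [uIcc_of_le ht, uIcc_of_le (block_le ht M k)]
      exact block_subset ht hk)
  push_cast at this
  rw [this]
  congr 1
  · simp
  · field_simp

/-- Left-endpoint Riemann sums with respect to a continuous density converge. -/
theorem tendsto_sum_mul_integral_blocks {t : ℝ} (ht : 0 ≤ t) {f g : ℝ → ℝ}
    (hf : ContinuousOn f (Icc 0 t)) (hg : ContinuousOn g (Icc 0 t)) :
    Tendsto (fun M : ℕ => ∑ k ∈ Finset.range M, f ((k : ℝ) * t / M) *
      ∫ s in ((k : ℝ) * t / M)..(((k : ℝ) + 1) * t / M), g s) atTop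
      (𝓝 (∫ s in 0..t, f s * g s)) := by
  obtain ⟨C, hC⟩ := isCompact_Icc.exists_bound_of_continuousOn hg
  have hC0 : 0 ≤ C := (norm_nonneg _).trans (hC 0 ⟨le_rfl, ht⟩)
  have hfg : IntervalIntegrable (fun s => f s * g s) volume 0 t := by
    apply ContinuousOn.intervalIntegrable
    rw [uIcc_of_le ht]
    exact hf.mul hg
  have hgi : IntervalIntegrable g volume 0 t := by
    apply ContinuousOn.intervalIntegrable
    rwa [uIcc_of_le ht]
  -- On each block the error is the integral of the oscillation of `f` times the bounded function
  -- `g`.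
  have key := tendsto_sum_integral_blocks ht
    (φ := fun M k s => (f ((k : ℝ) * t / M) - f s) * g s) (fun η hη => by
      filter_upwards [eventually_block_dist_le ht hf (show 0 < η / (C + 1) by positivity)]
        with M hM k hk s hs
      rw [norm_mul]
      calc _ ≤ η / (C + 1) * C := by
            gcongr
            · exact hM k hk _ ⟨le_rfl, block_le ht M k⟩ s hs
            · exact hC s (block_subset ht hk hs)
        _ ≤ η / (C + 1) * (C + 1) := by gcongr; linarith
        _ = η := by field_simp)
  have := key.add_const (∫ s in 0..t, f s * g s)
  rw [zero_add] at this
  refine this.congr' ?_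
  filter_upwards [eventually_gt_atTop 0] with M hM
  rw [← sum_integral_blocks ht hfg hM, ← Finset.sum_add_distrib]
  refine Finset.sum_congr rfl fun k hk => ?_
  have hsub : uIcc ((k : ℝ) * t / M) (((k : ℝ) + 1) * t / M) ⊆ uIcc 0 t := by
    rw [uIcc_of_le ht, uIcc_of_le (block_le ht M k)]
    exact block_subset ht (Finset.mem_range.1 hk)
  have h1 := hfg.mono_set hsub
  have h2 := hgi.mono_set hsub
  rw [← intervalIntegral.integral_const_mul, ← intervalIntegral.integral_add _ h1]
  · exact intervalIntegral.integral_congr fun s _ => by ring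
  · simp only [sub_mul]
    exact (h2.const_mul _).sub h1

theorem tendsto_riemannSum {a b : ℝ} (hab : a ≤ b) {f : ℝ → ℝ} (hf : ContinuousOn f (Icc a b)) :
    Tendsto (fun N : ℕ => ∑ j ∈ Finset.range N, f (a + (j : ℝ) * (b - a) / N) * ((b - a) / N))
      atTop (𝓝 (∫ s in a..b, f s)) := by
  have := tendsto_sum_mul_integral_blocks (t := b - a) (sub_nonneg.2 hab)
    (f := fun s => f (a + s)) (g := fun _ => 1)
    (hf.comp (by fun_prop) fun s hs => ⟨by linarith [hs.1], by linarith [hs.2]⟩)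
    continuousOn_const
  simp only [mul_one, intervalIntegral.integral_comp_add_left] at this
  rw [add_zero, add_sub_cancel] at this
  refine this.congr fun N => Finset.sum_congr rfl fun j _ => ?_
  rw [intervalIntegral.integral_const, smul_eq_mul, mul_one]
  congr 1
  ring

end Blocks

/-! ### Gaussian increments of the noise part of a solution -/

section Increments

variable {Ω : Type*} {mΩ : MeasurableSpace Ω} {P : Measure Ω}

theorem posSemidef_smul_one {n : ℕ} {c : ℝ} (hc : 0 ≤ c) :
    (c • (1 : Matrix (Fin n) (Fin n) ℝ)).PosSemidef :=
  Matrix.PosSemidef.one.smul hc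

theorem charFun_multivariateGaussian_smul_one {n : ℕ} {c : ℝ} (hc : 0 ≤ c) (u : E n) :
    charFun (multivariateGaussian 0 (c • (1 : Matrix (Fin n) (Fin n) ℝ))) u
      = Complex.exp ((-(‖u‖ ^ 2 * c / 2) : ℝ)) := by
  rw [charFun_multivariateGaussian (posSemidef_smul_one hc)]
  have h : u.ofLp ⬝ᵥ (c • (1 : Matrix (Fin n) (Fin n) ℝ)).mulVec u.ofLp = ‖u‖ ^ 2 * c := by
    rw [EuclideanSpace.real_norm_sq_eq, Matrix.smul_mulVec, Matrix.one_mulVec, dotProduct_smul,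
      smul_eq_mul, mul_comm, dotProduct]
    simp only [← sq]
  rw [h]
  simp

theorem inner_toEuclideanLin_left {m n : ℕ} (S : Matrix (Fin m) (Fin n) ℝ) (x : E n) (u : E m) :
    ⟪Matrix.toEuclideanLin S x, u⟫ = ⟪x, Matrix.toEuclideanLin S.transpose u⟫ := by
  have := Matrix.toEuclideanLin_conjTranspose_eq_adjoint S
  rw [Matrix.conjTranspose_eq_transpose_of_trivial] at this
  rw [this, LinearMap.adjoint_inner_right]

/-- Increments are peeled off one at a time: the last one is independent of `𝓕 (s N)`, which already
contains `ξ` and all the earlier increments. -/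
theorem IsWienerProcess.integral_exp_increments [IsProbabilityMeasure P]
    {𝓕 : Filtration ℝ≥0 mΩ} {m n : ℕ} {B : ℝ≥0 → Ω → E n} (hB : IsWienerProcess P 𝓕 B)
    {ξ : Ω → E m} (hξ : Measurable[𝓕 0] ξ) {s : ℕ → ℝ≥0} (hs : Monotone s) (u : E m)
    (θ : ℕ → E n) (N : ℕ) :
    ∫ ω, Complex.exp ((⟪ξ ω, u⟫ +
        ∑ k ∈ Finset.range N, ⟪B (s (k + 1)) ω - B (s k) ω, θ k⟫ : ℝ) * Complex.I) ∂P
      = charFun (P.map ξ) u *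
        Complex.exp ((-∑ k ∈ Finset.range N, ‖θ k‖ ^ 2 * (s (k + 1) - s k) / 2 : ℝ)) := by
  induction N with
  | zero =>
    have hξ' : Measurable ξ := hξ.mono (𝓕.le 0) le_rfl
    simp only [Finset.range_zero, Finset.sum_empty, add_zero, neg_zero, Complex.ofReal_zero,
      Complex.exp_zero, mul_one]
    rw [charFun_apply, integral_map hξ'.aemeasurable (by fun_prop)]
  | succ N ih =>
    set f : Ω → ℂ := fun ω => Complex.exp ((⟪ξ ω, u⟫ +
        ∑ k ∈ Finset.range N, ⟪B (s (k + 1)) ω - B (s k) ω, θ k⟫ : ℝ) * Complex.I) with hf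
    set g : Ω → ℂ := fun ω =>
      Complex.exp ((⟪B (s (N + 1)) ω - B (s N) ω, θ N⟫ : ℝ) * Complex.I) with hg
    have hBm : ∀ {a b : ℝ≥0}, a ≤ b → Measurable[𝓕 b] (B a) := fun {a b} h =>
      (hB.adapted a).mono (𝓕.mono h) le_rfl
    have hfm : Measurable[𝓕 (s N)] f := by
      have h1 : Measurable[𝓕 (s N)] ξ := hξ.mono (𝓕.mono zero_le) le_rfl
      have h2 : Measurable[𝓕 (s N)] fun ω =>
          ∑ k ∈ Finset.range N, ⟪B (s (k + 1)) ω - B (s k) ω, θ k⟫ := by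
        refine Finset.measurable_sum _ fun k hk => ?_
        have hk' := Finset.mem_range.1 hk
        have h3 : Measurable[𝓕 (s N)] fun ω => B (s (k + 1)) ω - B (s k) ω :=
          (hBm (hs (by omega))).sub (hBm (hs (by omega)))
        exact h3.inner measurable_const
      have h4 : Measurable[𝓕 (s N)] fun ω => ⟪ξ ω, u⟫ := h1.inner measurable_const
      have h5 := h4.add h2
      have h6 : Measurable fun x : ℝ => Complex.exp (x * Complex.I) := by fun_prop
      exact h6.comp h5
    have hgc : Measurable[MeasurableSpace.comap
        (fun ω => B (s (N + 1)) ω - B (s N) ω) inferInstance] g := by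
      have h6 : Measurable fun x : E n => Complex.exp ((⟪x, θ N⟫ : ℝ) * Complex.I) := by fun_prop
      exact h6.comp (comap_measurable _)
    have hind : IndepFun f g P := by
      rw [IndepFun_iff_Indep]
      exact indep_of_indep_of_le_left (indep_of_indep_of_le_right
        (hB.increment_indep _ _ (hs (Nat.le_succ N))) hgc.comap_le) hfm.comap_le
    have hfm' : Measurable f := hfm.mono (𝓕.le _) le_rfl
    have hΔ : Measurable fun ω => B (s (N + 1)) ω - B (s N) ω :=
      ((hB.adapted _).mono (𝓕.le _) le_rfl).sub ((hB.adapted _).mono (𝓕.le _) le_rfl)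
    have hgm : Measurable g := hgc.mono hΔ.comap_le le_rfl
    have hsplit : (fun ω => Complex.exp ((⟪ξ ω, u⟫ + ∑ k ∈ Finset.range (N + 1),
        ⟪B (s (k + 1)) ω - B (s k) ω, θ k⟫ : ℝ) * Complex.I)) = fun ω => f ω * g ω := by
      ext ω
      rw [hf, hg, ← Complex.exp_add, Finset.sum_range_succ]
      congr 1
      push_cast
      ring
    have hgI : ∫ ω, g ω ∂P =
        Complex.exp ((-(‖θ N‖ ^ 2 * (s (N + 1) - s N) / 2) : ℝ)) := by
      have hle : s N ≤ s (N + 1) := hs (Nat.le_succ N)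
      have hlaw := hB.increment_law _ _ hle
      rw [← charFun_multivariateGaussian_smul_one (sub_nonneg.2 (by exact_mod_cast hle)),
        ← hlaw.map_eq, charFun_apply, integral_map hΔ.aemeasurable (by fun_prop)]
    rw [hsplit, hind.integral_fun_mul_eq_mul_integral hfm'.aestronglyMeasurable
      hgm.aestronglyMeasurable, ih, hgI, mul_assoc, ← Complex.exp_add, Finset.sum_range_succ]
    congr 3
    push_cast
    ring

/-- Convergence in probability gives almost sure convergence only along a subsequence; finitely many
successive extractions serve several grid points at once. -/
theorem exists_common_subseq_tendsto_ae {F : Type*} [PseudoEMetricSpace F]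
    {f : ℕ → ℕ → Ω → F} {g : ℕ → Ω → F} (h : ∀ k, TendstoInMeasure P (f k) atTop (g k)) (K : ℕ) :
    ∃ ns : ℕ → ℕ, StrictMono ns ∧
      ∀ᵐ ω ∂P, ∀ k < K, Tendsto (fun i => f k (ns i) ω) atTop (𝓝 (g k ω)) := by
  induction K with
  | zero => exact ⟨id, strictMono_id, by simp⟩
  | succ K ih =>
    obtain ⟨ns, hns, hae⟩ := ih
    obtain ⟨ms, hms, hae'⟩ := ((h K).comp hns.tendsto_atTop).exists_seq_tendsto_ae
    refine ⟨ns ∘ ms, hns.comp hms, ?_⟩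
    filter_upwards [hae, hae'] with ω h1 h2 k hk
    rcases Nat.lt_succ_iff_lt_or_eq.1 hk with hk | rfl
    · exact (h1 k hk).comp hms.tendsto_atTop
    · exact h2

theorem sum_range_mul {A : Type*} [AddCommMonoid A] (f : ℕ → A) (M N : ℕ) :
    ∑ l ∈ Finset.range (M * N), f l
      = ∑ k ∈ Finset.range M, ∑ j ∈ Finset.range N, f (k * N + j) := by
  induction M with
  | zero => simp
  | succ M ih => rw [Nat.succ_mul, Finset.sum_range_add, ih, Finset.sum_range_succ]

/-- Cutting `[0, k t / M]` into `k N` pieces gives the initial part of the subdivision of `[0, t]`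
into `M N` pieces. The sums at different grid points are therefore nested, and their differences are
sums over single blocks. -/
theorem itoSum_mul_div {m n : ℕ} (G : ℝ → Matrix (Fin m) (Fin n) ℝ) (B : ℝ≥0 → Ω → E n)
    (t : ℝ≥0) {M N : ℕ} (hM : 0 < M) (hN : 0 < N) (k : ℕ) (ω : Ω) :
    itoSum G B (k * t / M) (k * N) ω = ∑ l ∈ Finset.range (k * N),
      Matrix.toEuclideanLin (G ((l : ℝ) * t / (M * N : ℕ)))
        (B (((l + 1 : ℕ) : ℝ≥0) * t / (M * N : ℕ)) ω - B ((l : ℝ≥0) * t / (M * N : ℕ)) ω) := by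
  rcases Nat.eq_zero_or_pos k with rfl | hk
  · simp [itoSum]
  have hk' : (k : ℝ) ≠ 0 := by exact_mod_cast hk.ne'
  have hM' : (M : ℝ) ≠ 0 := by exact_mod_cast hM.ne'
  have hN' : (N : ℝ) ≠ 0 := by exact_mod_cast hN.ne'
  have hk'' : (k : ℝ≥0) ≠ 0 := by exact_mod_cast hk.ne'
  have hM'' : (M : ℝ≥0) ≠ 0 := by exact_mod_cast hM.ne'
  have hN'' : (N : ℝ≥0) ≠ 0 := by exact_mod_cast hN.ne'
  refine Finset.sum_congr rfl fun l _ => ?_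
  have e1 : (l : ℝ) * ((k * t / M : ℝ≥0) : ℝ) / (k * N : ℕ) = (l : ℝ) * t / (M * N : ℕ) := by
    push_cast
    field_simp
  have e2 : ((l : ℝ≥0) + 1) * (k * t / M) / (k * N : ℕ)
      = ((l + 1 : ℕ) : ℝ≥0) * t / (M * N : ℕ) := by
    push_cast
    field_simp
  have e3 : (l : ℝ≥0) * (k * t / M) / (k * N : ℕ) = (l : ℝ≥0) * t / (M * N : ℕ) := by
    push_cast
    field_simp
  rw [e1, e2, e3]

/-- The process `V` on `[0, t]` starts from a centred Gaussian with covariance form `q` and has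
independent centred Gaussian increments with covariance form `2 (∫ ε) q`; the law is recorded
through characteristic functions along all equal subdivisions of `[0, t]`. -/
structure GaussianIncrements {m : ℕ} (P : Measure Ω) (t : ℝ≥0) (ε : ℝ → ℝ) (q : E m → ℝ)
    (V : ℝ≥0 → Ω → E m) : Prop where
  aemeasurable : ∀ s ≤ t, AEMeasurable (V s) P
  integral_exp : ∀ M : ℕ, 0 < M → ∀ (u : E m) (θ : ℕ → E m),
    ∫ ω, Complex.exp ((⟪V 0 ω, u⟫ + ∑ k ∈ Finset.range M,
        ⟪V (((k : ℝ≥0) + 1) * t / M) ω - V ((k : ℝ≥0) * t / M) ω, θ k⟫ : ℝ) * Complex.I) ∂P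
      = Complex.exp ((-(q u / 2 + ∑ k ∈ Finset.range M,
          q (θ k) * ∫ x in ((k : ℝ) * t / M)..(((k : ℝ) + 1) * t / M), ε x) : ℝ))

theorem GaussianIncrements.map {m m' : ℕ} {t : ℝ≥0} {ε : ℝ → ℝ} {q : E m → ℝ}
    {V : ℝ≥0 → Ω → E m} (h : GaussianIncrements P t ε q V) (A : E m →L[ℝ] E m') :
    GaussianIncrements P t ε (fun u => q (ContinuousLinearMap.adjoint A u))
      (fun s ω => A (V s ω)) where
  aemeasurable s hs := A.continuous.measurable.comp_aemeasurable (h.aemeasurable s hs)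
  integral_exp M hM u θ := by
    rw [← h.integral_exp M hM]
    simp_rw [ContinuousLinearMap.adjoint_inner_right, map_sub]

/-- The part of the process `X` that is not due to the drift. -/
noncomputable def noisePart {m : ℕ} (drift : ℝ → E m → E m) (X : ℝ≥0 → Ω → E m) (s : ℝ≥0)
    (ω : Ω) : E m :=
  X s ω - ∫ x in (0 : ℝ)..s, drift x (X x.toNNReal ω)

theorem noisePart_zero {m : ℕ} (drift : ℝ → E m → E m) (X : ℝ≥0 → Ω → E m) (ω : Ω) :
    noisePart drift X 0 ω = X 0 ω := by
  simp [noisePart]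

theorem measurable_itoSum {m n : ℕ} {𝓕 : Filtration ℝ≥0 mΩ} {G : ℝ → Matrix (Fin m) (Fin n) ℝ}
    {B : ℝ≥0 → Ω → E n} (hB : IsWienerProcess P 𝓕 B) (t : ℝ≥0) (N : ℕ) :
    Measurable (itoSum G B t N) := by
  have hBm : ∀ s, Measurable (B s) := fun s => (hB.adapted s).mono (𝓕.le s) le_rfl
  unfold itoSum
  refine Finset.measurable_sum _ fun k _ => ?_
  exact (LinearMap.continuous_of_finiteDimensional _).measurable.comp ((hBm _).sub (hBm _))

/-- Along a common subsequence the Itô sums at the grid points converge almost surely, and their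
joint characteristic function is explicit because it involves only Wiener increments and `X 0`.
Dominated convergence on one side and Riemann sums of `ε` on the other identify the limit. -/
theorem IsSDESolution.gaussianIncrements [IsProbabilityMeasure P] {𝓕 : Filtration ℝ≥0 mΩ}
    {m n : ℕ} {T : ℝ} {drift : ℝ → E m → E m} {ε : ℝ → ℝ} {S : Matrix (Fin m) (Fin n) ℝ}
    {B : ℝ≥0 → Ω → E n} {X : ℝ≥0 → Ω → E m}
    (hX : IsSDESolution P 𝓕 T drift (fun x => √(2 * ε x) • S) B X)
    (hX0 : ∀ u, charFun (P.map (X 0)) u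
      = Complex.exp ((-(‖Matrix.toEuclideanLin S.transpose u‖ ^ 2 / 2) : ℝ)))
    {t : ℝ≥0} (ht : (t : ℝ) < T) (hε : ContinuousOn ε (Icc 0 t))
    (hε0 : ∀ x ∈ Icc 0 (t : ℝ), 0 ≤ ε x) :
    GaussianIncrements P t ε (fun u => ‖Matrix.toEuclideanLin S.transpose u‖ ^ 2)
      (noisePart drift X) := by
  set G : ℝ → Matrix (Fin m) (Fin n) ℝ := fun x => √(2 * ε x) • S with hG
  have ht0 : (0 : ℝ) ≤ t := t.2
  have h0T : ((0 : ℝ≥0) : ℝ) < T := lt_of_le_of_lt ht0 ht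
  have hX0m : Measurable[𝓕 0] (X 0) := hX.adapted 0 h0T
  have hX0m' : Measurable (X 0) := hX0m.mono (𝓕.le 0) le_rfl
  have hdiff : ∀ s : ℝ≥0, (fun ω => X s ω - X 0 ω - ∫ x in (0 : ℝ)..s, drift x (X x.toNNReal ω))
      = fun ω => noisePart drift X s ω - X 0 ω := fun s => by
    ext1 ω
    simp only [noisePart]
    abel
  have heq : ∀ s : ℝ≥0, s ≤ t → TendstoInMeasure P (itoSum G B s) atTop
      (fun ω => noisePart drift X s ω - X 0 ω) := fun s hs => by
    rw [← hdiff]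
    exact hX.equation s (lt_of_le_of_lt (by exact_mod_cast hs) ht)
  have hmeas : ∀ s ≤ t, AEMeasurable (noisePart drift X s) P := fun s hs => by
    have := (heq s hs).aemeasurable fun N => (measurable_itoSum hX.wiener s N).aemeasurable
    refine (this.add hX0m'.aemeasurable).congr (ae_of_all _ fun ω => ?_)
    simp
  refine ⟨hmeas, fun M hM u θ => ?_⟩
  have hM0 : (M : ℝ) ≠ 0 := by exact_mod_cast hM.ne'
  have hM1 : (0 : ℝ) < M := by exact_mod_cast hM
  set V := noisePart drift X with hV
  have hgrid : ∀ k ≤ M, (k : ℝ≥0) * t / M ≤ t := fun k hk => by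
    have hM' : (0 : ℝ≥0) < M := by exact_mod_cast hM
    rw [div_le_iff₀ hM', mul_comm t]
    gcongr
  -- simultaneous almost sure convergence along a subsequence
  have hconv : ∀ k : ℕ, TendstoInMeasure P
      (fun N => itoSum G B ((min k M : ℕ) * t / M) (min k M * N)) atTop
      (fun ω => V ((min k M : ℕ) * t / M) ω - X 0 ω) := fun k => by
    -- Clamping by `M` gives a family indexed by all of `ℕ`. Index `0` is separate: the number of
    -- pieces then stays `0`, but the empty sum and the target both vanish.
    rcases Nat.eq_zero_or_pos (min k M) with h0 | hpos
    · rw [h0]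
      refine TendstoInMeasure.congr_right (g := 0) (ae_of_all _ fun ω => ?_) ?_
      · simp [hV, noisePart]
      · have : (fun N : ℕ => itoSum G B ((0 : ℕ) * t / M) (0 * N)) = fun _ => (0 : Ω → E m) := by
          ext N ω
          simp [itoSum]
        rw [this]
        intro η hη
        simp [hη.not_ge]
    · exact (heq _ (hgrid _ (min_le_right _ _))).comp
        (tendsto_id.const_mul_atTop' hpos)
  obtain ⟨ns, hns, hae⟩ := exists_common_subseq_tendsto_ae hconv (M + 1)
  have hae : ∀ᵐ ω ∂P, ∀ k ≤ M, Tendsto (fun i => itoSum G B ((k : ℝ≥0) * t / M) (k * ns i) ω) atTop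
      (𝓝 (V ((k : ℝ≥0) * t / M) ω - X 0 ω)) := by
    filter_upwards [hae] with ω hω k hk
    have := hω k (by omega)
    rwa [min_eq_left hk] at this
  -- the approximating exponentials
  set a : ℕ → Ω → ℝ := fun N ω => ⟪X 0 ω, u⟫ + ∑ k ∈ Finset.range M,
    ⟪itoSum G B (((k + 1 : ℕ) : ℝ≥0) * t / M) ((k + 1) * N) ω
      - itoSum G B ((k : ℝ≥0) * t / M) (k * N) ω, θ k⟫ with ha
  have ham : ∀ N, Measurable (a N) := fun N => by
    refine (hX0m'.inner measurable_const).add (Finset.measurable_sum _ fun k _ => ?_)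
    exact ((measurable_itoSum hX.wiener _ _).sub
      (measurable_itoSum hX.wiener _ _)).inner measurable_const
  have hlim1 : Tendsto (fun i => ∫ ω, Complex.exp (a (ns i) ω * Complex.I) ∂P) atTop
      (𝓝 (∫ ω, Complex.exp ((⟪V 0 ω, u⟫ + ∑ k ∈ Finset.range M,
        ⟪V (((k : ℝ≥0) + 1) * t / M) ω - V ((k : ℝ≥0) * t / M) ω, θ k⟫ : ℝ) * Complex.I) ∂P)) := by
    refine tendsto_integral_of_dominated_convergence (fun _ => (1 : ℝ)) (fun i => ?_)
      (integrable_const _) (fun i => ae_of_all _ fun ω => ?_) ?_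
    · have := ham (ns i)
      exact Measurable.aestronglyMeasurable (by fun_prop)
    · rw [Complex.norm_exp_ofReal_mul_I]
    · filter_upwards [hae] with ω hω
      have h1 : Tendsto (fun i => a (ns i) ω) atTop (𝓝 (⟪V 0 ω, u⟫ + ∑ k ∈ Finset.range M,
          ⟪V (((k : ℝ≥0) + 1) * t / M) ω - V ((k : ℝ≥0) * t / M) ω, θ k⟫)) := by
        rw [hV, noisePart_zero, ← hV]
        refine tendsto_const_nhds.add (tendsto_finsetSum _ fun k hk => ?_)
        have hk' := Finset.mem_range.1 hk
        have h2 := (hω (k + 1) hk').sub (hω k hk'.le)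
        rw [sub_sub_sub_cancel_right] at h2
        push_cast at h2 ⊢
        exact h2.inner tendsto_const_nhds
      exact (Complex.continuous_exp.tendsto _).comp
        ((Complex.continuous_ofReal.tendsto _).comp h1 |>.mul_const _)
  have hval : ∀ N : ℕ, 0 < N → ∫ ω, Complex.exp (a N ω * Complex.I) ∂P
      = Complex.exp ((-(‖Matrix.toEuclideanLin S.transpose u‖ ^ 2 / 2 +
        ∑ k ∈ Finset.range M, ‖Matrix.toEuclideanLin S.transpose (θ k)‖ ^ 2 *
          ∑ j ∈ Finset.range N, ε ((k : ℝ) * t / M + (j : ℝ) *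
            (((k : ℝ) + 1) * t / M - (k : ℝ) * t / M) / N) *
            ((((k : ℝ) + 1) * t / M - (k : ℝ) * t / M) / N)) : ℝ)) := fun N hN => by
    have hN0 : (N : ℝ) ≠ 0 := by exact_mod_cast hN.ne'
    set s : ℕ → ℝ≥0 := fun l => (l : ℝ≥0) * t / (M * N : ℕ) with hs
    have hsm : Monotone s := fun i j hij => by
      simp only [hs]
      gcongr
    -- The fine piece `l` lies in the coarse block `l / N`, so it is tested against `θ (l / N)`,
    -- with the integrand moved across by transposition. The factor `2` in `√(2ε)` cancels the `1/2`
    -- of the Gaussian exponent.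
    set ϑ : ℕ → E n := fun l =>
      √(2 * ε ((l : ℝ) * t / (M * N : ℕ))) • Matrix.toEuclideanLin S.transpose (θ (l / N)) with hϑ
    have hdivN : ∀ k j, j < N → (k * N + j) / N = k := fun k j hj => by
      rw [mul_comm, Nat.mul_add_div hN, Nat.div_eq_of_lt hj, add_zero]
    have e1 : ∀ ω, a N ω = ⟪X 0 ω, u⟫ +
        ∑ l ∈ Finset.range (M * N), ⟪B (s (l + 1)) ω - B (s l) ω, ϑ l⟫ := fun ω => by
      rw [sum_range_mul]
      simp only [ha]
      congr 1
      refine Finset.sum_congr rfl fun k _ => ?_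
      rw [itoSum_mul_div G B t hM hN, itoSum_mul_div G B t hM hN, Nat.succ_mul,
        Finset.sum_range_add, add_sub_cancel_left, sum_inner]
      refine Finset.sum_congr rfl fun j hj => ?_
      rw [inner_toEuclideanLin_left]
      simp only [hG, hϑ, hdivN k j (Finset.mem_range.1 hj), Matrix.transpose_smul, map_smul,
        LinearMap.smul_apply, hs]
    simp_rw [e1]
    rw [hX.wiener.integral_exp_increments hX0m hsm, hX0, ← Complex.exp_add, ← Complex.ofReal_add,
      sum_range_mul]
    congr 2
    rw [neg_add, add_right_inj, neg_inj]
    refine Finset.sum_congr rfl fun k hk => ?_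
    rw [Finset.mul_sum]
    refine Finset.sum_congr rfl fun j hj => ?_
    have e2 : (((k * N + j : ℕ) : ℝ) * t / (M * N : ℕ)) = (k : ℝ) * t / M + (j : ℝ) *
            (((k : ℝ) + 1) * t / M - (k : ℝ) * t / M) / N := by
      push_cast
      field_simp
      ring
    have hmem : (((k * N + j : ℕ) : ℝ) * t / (M * N : ℕ)) ∈ Icc (0 : ℝ) t := by
      refine block_subset ht0 (M := M * N) (k := k * N + j) ?_ ⟨le_rfl, block_le ht0 _ _⟩
      have h1 := Finset.mem_range.1 hk
      have h2 := Finset.mem_range.1 hj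
      calc k * N + j < k * N + N := by omega
        _ = (k + 1) * N := by ring
        _ ≤ M * N := Nat.mul_le_mul_right _ h1
    have h3 : 0 ≤ ε (((k * N + j : ℕ) : ℝ) * t / (M * N : ℕ)) := hε0 _ hmem
    simp only [hϑ, hdivN k j (Finset.mem_range.1 hj), norm_smul, mul_pow, Real.norm_eq_abs, sq_abs]
    rw [Real.sq_sqrt (by positivity), ← e2]
    simp only [hs]
    push_cast
    field_simp
    ring
  have hlim2 : Tendsto (fun i => ∫ ω, Complex.exp (a (ns i) ω * Complex.I) ∂P) atTop
      (𝓝 (Complex.exp ((-(‖Matrix.toEuclideanLin S.transpose u‖ ^ 2 / 2 +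
        ∑ k ∈ Finset.range M, ‖Matrix.toEuclideanLin S.transpose (θ k)‖ ^ 2 *
          ∫ x in ((k : ℝ) * t / M)..(((k : ℝ) + 1) * t / M), ε x) : ℝ)))) := by
    have h1 : Tendsto (fun N : ℕ => Complex.exp ((-(‖Matrix.toEuclideanLin S.transpose u‖ ^ 2 / 2 +
        ∑ k ∈ Finset.range M, ‖Matrix.toEuclideanLin S.transpose (θ k)‖ ^ 2 *
          ∑ j ∈ Finset.range N, ε ((k : ℝ) * t / M + (j : ℝ) *
            (((k : ℝ) + 1) * t / M - (k : ℝ) * t / M) / N) *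
            ((((k : ℝ) + 1) * t / M - (k : ℝ) * t / M) / N)) : ℝ))) atTop
        (𝓝 (Complex.exp ((-(‖Matrix.toEuclideanLin S.transpose u‖ ^ 2 / 2 +
        ∑ k ∈ Finset.range M, ‖Matrix.toEuclideanLin S.transpose (θ k)‖ ^ 2 *
          ∫ x in ((k : ℝ) * t / M)..(((k : ℝ) + 1) * t / M), ε x) : ℝ)))) := by
      refine (Complex.continuous_exp.tendsto _).comp ((Complex.continuous_ofReal.tendsto _).comp ?_)
      refine (tendsto_const_nhds.add (tendsto_finsetSum _ fun k hk => ?_)).neg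
      refine Tendsto.const_mul _ (tendsto_riemannSum (block_le ht0 M k) (hε.mono ?_))
      exact block_subset ht0 (Finset.mem_range.1 hk)
    refine (h1.comp hns.tendsto_atTop).congr' ?_
    filter_upwards [hns.tendsto_atTop.eventually (eventually_gt_atTop 0)] with i hi
    exact (hval _ hi).symm
  exact tendsto_nhds_unique hlim1 hlim2

end Increments

/-! ### Finite-dimensional laws at rational multiples of the horizon -/

section RationalTimes

variable {Ω : Type*} {mΩ : MeasurableSpace Ω} {P : Measure Ω}

/-- Summation by parts: `V` at grid point `κ i` is `V 0` plus the increments of index below `κ i`,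
so increment `k` is tested against the sum of those `u i` with `k < κ i`. -/
theorem GaussianIncrements.integral_exp_grid {m : ℕ} {t : ℝ≥0} {ε : ℝ → ℝ} {q : E m → ℝ}
    {V : ℝ≥0 → Ω → E m} (h : GaussianIncrements P t ε q V) {ι : Type*} [Fintype ι] {M : ℕ}
    (hM : 0 < M) (κ : ι → ℕ) (hκ : ∀ i, κ i ≤ M) (u : ι → E m) :
    ∫ ω, Complex.exp ((∑ i, ⟪V ((κ i : ℝ≥0) * t / M) ω, u i⟫ : ℝ) * Complex.I) ∂P
      = Complex.exp ((-(q (∑ i, u i) / 2 + ∑ k ∈ Finset.range M,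
          q (∑ i, if k < κ i then u i else 0) *
            ∫ x in ((k : ℝ) * t / M)..(((k : ℝ) + 1) * t / M), ε x) : ℝ)) := by
  rw [← h.integral_exp M hM]
  congr 1 with ω
  congr 3
  set v : ℕ → E m := fun k => V ((k : ℝ≥0) * t / M) ω with hv
  have hv0 : V 0 ω = v 0 := by simp [hv]
  have hv1 : ∀ k : ℕ, V (((k : ℝ≥0) + 1) * t / M) ω = v (k + 1) := fun k => by simp [hv]
  have h1 : ∀ i, ⟪v (κ i), u i⟫ = ⟪v 0, u i⟫ +
      ∑ k ∈ Finset.range M, ⟪v (k + 1) - v k, if k < κ i then u i else 0⟫ := fun i => by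
    have h2 : ∀ k, ⟪v (k + 1) - v k, if k < κ i then u i else 0⟫ =
        if k < κ i then ⟪v (k + 1) - v k, u i⟫ else 0 := fun k => by
      split_ifs <;> simp
    simp_rw [h2]
    rw [← Finset.sum_filter, show (Finset.range M).filter (fun k => k < κ i)
      = Finset.range (κ i) by
        ext k
        have := hκ i
        simp only [Finset.mem_filter, Finset.mem_range]
        omega, ← sum_inner, Finset.sum_range_sub, ← inner_add_left, add_sub_cancel]
  change ∑ i, ⟪v (κ i), u i⟫ = _
  simp_rw [hv0, hv1, h1, Finset.sum_add_distrib, ← inner_sum]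
  rw [Finset.sum_comm]
  simp_rw [← inner_sum]
  rfl

/-- The time in `[0, t]` that is the fraction `a` of `t`, where `a` is clamped to `[0, 1]`. -/
noncomputable def ratTime (t : ℝ≥0) (a : ℚ) : ℝ≥0 := min (Real.toNNReal a) 1 * t

theorem ratTime_le (t : ℝ≥0) (a : ℚ) : ratTime t a ≤ t :=
  mul_le_of_le_one_left' (min_le_right _ _)

theorem exists_clamp_eq_div (a : ℚ) :
    ∃ M : ℕ, 0 < M ∧ ∃ k ≤ M, min (Real.toNNReal a) 1 = (k : ℝ≥0) / M := by
  rcases le_or_gt a 0 with h0 | h0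
  · refine ⟨1, one_pos, 0, zero_le_one, ?_⟩
    rw [Real.toNNReal_of_nonpos (by exact_mod_cast h0)]
    simp
  rcases le_or_gt 1 a with h1 | h1
  · refine ⟨1, one_pos, 1, le_rfl, ?_⟩
    have : (1 : ℝ≥0) ≤ Real.toNNReal a := by
      rw [Real.one_le_toNNReal]
      exact_mod_cast h1
    simp [min_eq_right this]
  have hn : 0 < a.num := Rat.num_pos.2 h0
  have hval : a = (a.num.toNat : ℚ) / a.den := by
    conv_lhs => rw [← Rat.num_div_den a]
    congr 1
    have : ((a.num.toNat : ℤ) : ℚ) = (a.num : ℚ) := by rw [Int.toNat_of_nonneg hn.le]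
    exact_mod_cast this.symm
  have hden : (0 : ℚ) < a.den := by exact_mod_cast a.pos
  have hk : a.num.toNat ≤ a.den := by
    rw [hval, div_lt_one hden] at h1
    exact_mod_cast h1.le
  refine ⟨a.den, a.pos, a.num.toNat, hk, ?_⟩
  have : Real.toNNReal a = (a.num.toNat : ℝ≥0) / a.den := by
    apply NNReal.coe_injective
    rw [Real.coe_toNNReal _ (by exact_mod_cast h0.le)]
    conv_lhs => rw [hval]
    push_cast
    rfl
  rw [← this]
  apply min_eq_left
  rw [Real.toNNReal_le_one]
  exact_mod_cast h1.le

/-- This is why equal subdivisions suffice in `GaussianIncrements`: any finite set of rational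
fractions of `t` lies on one of them. -/
theorem exists_common_denominator (t : ℝ≥0) (I : Finset ℚ) :
    ∃ M : ℕ, 0 < M ∧ ∃ κ : ℚ → ℕ, ∀ a ∈ I, κ a ≤ M ∧ ratTime t a = (κ a : ℝ≥0) * t / M := by
  induction I using Finset.induction with
  | empty => exact ⟨1, one_pos, fun _ => 0, by simp⟩
  | insert a I ha ih =>
    obtain ⟨M, hM, κ, hκ⟩ := ih
    obtain ⟨M', hM', k, hk, hka⟩ := exists_clamp_eq_div a
    have hM0 : (M : ℝ≥0) ≠ 0 := by exact_mod_cast hM.ne'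
    have hM0' : (M' : ℝ≥0) ≠ 0 := by exact_mod_cast hM'.ne'
    refine ⟨M * M', Nat.mul_pos hM hM', fun b => if b = a then M * k else κ b * M', ?_⟩
    intro b hb
    by_cases hba : b = a
    · subst hba
      simp only [if_true]
      refine ⟨Nat.mul_le_mul_left _ hk, ?_⟩
      rw [ratTime, hka]
      push_cast
      field_simp
    · have hbI : b ∈ I := (Finset.mem_insert.1 hb).resolve_left hba
      simp only [hba, if_false]
      refine ⟨Nat.mul_le_mul_right _ (hκ b hbI).1, ?_⟩
      rw [(hκ b hbI).2]
      push_cast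
      field_simp

theorem exists_eq_sum_inner {ι : Type*} [Fintype ι] {m : ℕ} (L : StrongDual ℝ (ι → E m)) :
    ∃ a : ι → E m, ∀ x, L x = ∑ i, ⟪x i, a i⟫ := by
  classical
  refine ⟨fun i => (InnerProductSpace.toDual ℝ (E m)).symm
    (L.comp (ContinuousLinearMap.single ℝ (fun _ : ι => E m) i)), fun x => ?_⟩
  conv_lhs => rw [← Finset.univ_sum_single x]
  rw [map_sum]
  refine Finset.sum_congr rfl fun i _ => ?_
  rw [real_inner_comm, InnerProductSpace.toDual_symm_apply]
  rfl

/-- Additivity of `q` across the two adjoint ranges splits every exponent in the joint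
characteristic function. Finite-dimensional independence then extends to the whole families of
rational times. -/
theorem GaussianIncrements.indepFun [IsProbabilityMeasure P] {m m₁ m₂ : ℕ} {t : ℝ≥0}
    {ε : ℝ → ℝ} {q : E m → ℝ} {V : ℝ≥0 → Ω → E m} (h : GaussianIncrements P t ε q V)
    (A₁ : E m →L[ℝ] E m₁) (A₂ : E m →L[ℝ] E m₂)
    (hq : ∀ a c, q (ContinuousLinearMap.adjoint A₁ a + ContinuousLinearMap.adjoint A₂ c)
      = q (ContinuousLinearMap.adjoint A₁ a) + q (ContinuousLinearMap.adjoint A₂ c)) :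
    IndepFun (fun ω (a : ℚ) => A₁ (V (ratTime t a) ω)) (fun ω (a : ℚ) => A₂ (V (ratTime t a) ω))
      P := by
  have hm₁ : ∀ a : ℚ, AEMeasurable (fun ω => A₁ (V (ratTime t a) ω)) P := fun a =>
    A₁.continuous.measurable.comp_aemeasurable (h.aemeasurable _ (ratTime_le t a))
  have hm₂ : ∀ a : ℚ, AEMeasurable (fun ω => A₂ (V (ratTime t a) ω)) P := fun a =>
    A₂.continuous.measurable.comp_aemeasurable (h.aemeasurable _ (ratTime_le t a))
  refine IndepFun.process_indepFun_process₀ hm₁ hm₂ fun I J => ?_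
  have hI : AEMeasurable (fun ω (i : I) => A₁ (V (ratTime t i) ω)) P :=
    aemeasurable_pi_lambda _ fun i => hm₁ i
  have hJ : AEMeasurable (fun ω (j : J) => A₂ (V (ratTime t j) ω)) P :=
    aemeasurable_pi_lambda _ fun j => hm₂ j
  rw [indepFun_iff_charFunDual_prod hI hJ]
  intro L
  obtain ⟨a, ha⟩ := exists_eq_sum_inner
    (L.comp (ContinuousLinearMap.inl ℝ (I → E m₁) (J → E m₂)))
  obtain ⟨c, hc⟩ := exists_eq_sum_inner
    (L.comp (ContinuousLinearMap.inr ℝ (I → E m₁) (J → E m₂)))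
  have hL : ∀ x y, L (x, y) = ∑ i, ⟪x i, a i⟫ + ∑ j, ⟪y j, c j⟫ := fun x y => by
    rw [← ha, ← hc]
    simp [← map_add]
  obtain ⟨M, hM, κ, hκ⟩ := exists_common_denominator t (I ∪ J)
  have hκI : ∀ i : I, κ i ≤ M ∧ ratTime t i = (κ i : ℝ≥0) * t / M := fun i =>
    hκ i (Finset.mem_union_left _ i.2)
  have hκJ : ∀ j : J, κ j ≤ M ∧ ratTime t j = (κ j : ℝ≥0) * t / M := fun j =>
    hκ j (Finset.mem_union_right _ j.2)
  rw [charFunDual_apply, charFunDual_apply, charFunDual_apply,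
    integral_map (hI.prodMk hJ) (by fun_prop), integral_map hI (by fun_prop),
    integral_map hJ (by fun_prop)]
  simp_rw [hL, ha, hc, (hκI _).2, (hκJ _).2, ← ContinuousLinearMap.adjoint_inner_right]
  have e1 := h.integral_exp_grid hM (fun i : I => κ i) (fun i => (hκI i).1)
    (fun i => ContinuousLinearMap.adjoint A₁ (a i))
  have e2 := h.integral_exp_grid hM (fun j : J => κ j) (fun j => (hκJ j).1)
    (fun j => ContinuousLinearMap.adjoint A₂ (c j))
  -- Indexing by `I ⊕ J` treats the joint vector as one family of test vectors for the same process
  -- `V`, so the grid formula applies a third time.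
  obtain ⟨K, hKI, hKJ⟩ : ∃ K : I ⊕ J → ℕ, (∀ i, K (Sum.inl i) = κ i) ∧
      ∀ j, K (Sum.inr j) = κ j := ⟨Sum.elim (fun i => κ i) (fun j => κ j), by simp, by simp⟩
  have e3 := h.integral_exp_grid hM K
    (by rintro (i | j); exacts [(hKI i).trans_le (hκI i).1, (hKJ j).trans_le (hκJ j).1])
    (Sum.elim (fun i => ContinuousLinearMap.adjoint A₁ (a i))
      (fun j => ContinuousLinearMap.adjoint A₂ (c j)))
  simp only [Fintype.sum_sum_type, Sum.elim_inl, Sum.elim_inr, hKI, hKJ] at e3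
  rw [e1, e2, e3, ← Complex.exp_add, ← Complex.ofReal_add]
  have hite₁ : ∀ (k : ℕ), ∑ i : I, (if k < κ i then ContinuousLinearMap.adjoint A₁ (a i) else 0)
      = ContinuousLinearMap.adjoint A₁ (∑ i : I, if k < κ i then a i else 0) := fun k => by
    rw [map_sum]
    exact Finset.sum_congr rfl fun i _ => by split_ifs <;> simp
  have hite₂ : ∀ (k : ℕ), ∑ j : J, (if k < κ j then ContinuousLinearMap.adjoint A₂ (c j) else 0)
      = ContinuousLinearMap.adjoint A₂ (∑ j : J, if k < κ j then c j else 0) := fun k => by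
    rw [map_sum]
    exact Finset.sum_congr rfl fun i _ => by split_ifs <;> simp
  simp_rw [hite₁, hite₂, ← map_sum, hq, add_mul, Finset.sum_add_distrib]
  congr 2
  ring

/-- The grid formula depends only on `t`, `ε` and `q`, so the finite-dimensional laws agree; a
projective limit of finite measures is unique. -/
theorem GaussianIncrements.map_ratTime_eq [IsProbabilityMeasure P] {Ω' : Type*}
    {mΩ' : MeasurableSpace Ω'} {P' : Measure Ω'} [IsProbabilityMeasure P'] {m : ℕ} {t : ℝ≥0}
    {ε : ℝ → ℝ} {q : E m → ℝ} {V : ℝ≥0 → Ω → E m} {V' : ℝ≥0 → Ω' → E m}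
    (h : GaussianIncrements P t ε q V) (h' : GaussianIncrements P' t ε q V') :
    P.map (fun ω (a : ℚ) => V (ratTime t a) ω) = P'.map (fun ω (a : ℚ) => V' (ratTime t a) ω) := by
  have hm : ∀ a : ℚ, AEMeasurable (V (ratTime t a)) P := fun a =>
    h.aemeasurable _ (ratTime_le t a)
  have hm' : ∀ a : ℚ, AEMeasurable (V' (ratTime t a)) P' := fun a =>
    h'.aemeasurable _ (ratTime_le t a)
  have hl := isProjectiveLimit_map (aemeasurable_pi_lambda _ hm)
  have hl' := isProjectiveLimit_map (aemeasurable_pi_lambda _ hm')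
  have hfd : ∀ I : Finset ℚ, P.map (fun ω => I.restrict fun a => V (ratTime t a) ω)
      = P'.map (fun ω => I.restrict fun a => V' (ratTime t a) ω) := fun I => by
    have hI : AEMeasurable (fun ω => I.restrict fun a => V (ratTime t a) ω) P :=
      aemeasurable_pi_lambda _ fun i => hm i
    have hI' : AEMeasurable (fun ω => I.restrict fun a => V' (ratTime t a) ω) P' :=
      aemeasurable_pi_lambda _ fun i => hm' i
    have := Measure.isProbabilityMeasure_map hI
    have := Measure.isProbabilityMeasure_map hI'
    refine Measure.ext_of_charFunDual (funext fun L => ?_)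
    obtain ⟨a, ha⟩ := exists_eq_sum_inner L
    obtain ⟨M, hM, κ, hκ⟩ := exists_common_denominator t I
    rw [charFunDual_apply, charFunDual_apply, integral_map hI (by fun_prop),
      integral_map hI' (by fun_prop)]
    simp_rw [ha, Finset.restrict, (hκ _ (Subtype.prop _)).2]
    rw [h.integral_exp_grid hM (fun i : I => κ i) (fun i => (hκ _ i.2).1) a,
      h'.integral_exp_grid hM (fun i : I => κ i) (fun i => (hκ _ i.2).1) a]
  have : ∀ I : Finset ℚ, IsFiniteMeasure
      (P'.map (fun ω => I.restrict fun a => V' (ratTime t a) ω)) := fun I => inferInstance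
  refine hl.unique (P := fun I => P.map (fun ω => I.restrict fun a => V (ratTime t a) ω)) ?_
  simp_rw [hfd]
  exact hl'

end RationalTimes

/-! ### Linear equations driven by a process with Gaussian increments -/

section Linear

/-- Variation of constants, in the form of convergence of Riemann–Stieltjes sums. -/
theorem tendsto_sum_exp_smul_increments {F : Type*} [NormedAddCommGroup F] [NormedSpace ℝ F]
    [CompleteSpace F] {t : ℝ} (ht : 0 ≤ t) {D : ℝ → ℝ} (hD : Continuous D) {y v : ℝ → F}
    (hy : Continuous y) (hv : ∀ s ∈ Icc 0 t, v s = y s - ∫ x in 0..s, D x • y x) :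
    Tendsto (fun M : ℕ => v 0 + ∑ k ∈ Finset.range M,
      Real.exp (-∫ x in 0..((k : ℝ) * t / M), D x) •
        (v (((k : ℝ) + 1) * t / M) - v ((k : ℝ) * t / M))) atTop
      (𝓝 (Real.exp (-∫ x in 0..t, D x) • y t)) := by
  set c : ℝ → ℝ := fun s => Real.exp (-∫ x in 0..s, D x) with hc
  have hcd : ∀ s, HasDerivAt c (-(D s * c s)) s := fun s => by
    have h1 : HasDerivAt (fun s => ∫ x in 0..s, D x) (D s) s :=
      (hD.integral_hasStrictDerivAt 0 s).hasDerivAt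
    refine h1.fun_neg.exp.congr_deriv ?_
    simp only [hc]
    ring
  have hcc : Continuous c := continuous_iff_continuousAt.2 fun s => (hcd s).continuousAt
  have hcI : ∀ a b, c b - c a = ∫ x in a..b, -(D x * c x) := fun a b =>
    (intervalIntegral.integral_eq_sub_of_hasDerivAt (fun s _ => hcd s)
      ((hD.mul hcc).neg.intervalIntegrable _ _)).symm
  have hc0 : c 0 = 1 := by simp [hc]
  obtain ⟨CD, hCD⟩ := isCompact_Icc.exists_bound_of_continuousOn (hD.continuousOn (s := Icc 0 t))
  obtain ⟨Cc, hCc⟩ := isCompact_Icc.exists_bound_of_continuousOn (hcc.continuousOn (s := Icc 0 t))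
  obtain ⟨Cy, hCy⟩ := isCompact_Icc.exists_bound_of_continuousOn (hy.continuousOn (s := Icc 0 t))
  have h0 : (0 : ℝ) ∈ Icc 0 t := ⟨le_rfl, ht⟩
  have hCD0 : 0 ≤ CD := (norm_nonneg _).trans (hCD 0 h0)
  have hCc0 : 0 ≤ Cc := (norm_nonneg _).trans (hCc 0 h0)
  have hCy0 : 0 ≤ Cy := (norm_nonneg _).trans (hCy 0 h0)
  -- On a block `[a, b]`, the identity `c b • y b - c a • y a = c a • (y b - y a) + (c b - c a) • y
  -- b` combines with the integral equations for `y` and `c`. What it leaves beyond `c a • (v b - v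
  -- a)` is the integral below, small by uniform continuity. No variation bound on `v` is needed.
  have key := tendsto_sum_integral_blocks ht (φ := fun M k s =>
    D s • (c ((k : ℝ) * t / M) • y s - c s • y (((k : ℝ) + 1) * t / M))) (fun η hη => by
      set K := CD * (Cy + Cc) + 1 with hK
      have hK0 : 0 < K := by positivity
      filter_upwards [eventually_block_dist_le ht hcc.continuousOn (show 0 < η / K by positivity),
        eventually_block_dist_le ht hy.continuousOn (show 0 < η / K by positivity)]
        with M h1 h2 k hk s hs
      have hl : (k : ℝ) * t / M ∈ Icc ((k : ℝ) * t / M) (((k : ℝ) + 1) * t / M) :=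
        ⟨le_rfl, block_le ht M k⟩
      have hr : ((k : ℝ) + 1) * t / M ∈ Icc ((k : ℝ) * t / M) (((k : ℝ) + 1) * t / M) :=
        ⟨block_le ht M k, le_rfl⟩
      have hs' := block_subset ht hk hs
      have e : c ((k : ℝ) * t / M) • y s - c s • y (((k : ℝ) + 1) * t / M)
          = (c ((k : ℝ) * t / M) - c s) • y s + c s • (y s - y (((k : ℝ) + 1) * t / M)) := by
        module
      calc ‖D s • (c ((k : ℝ) * t / M) • y s - c s • y (((k : ℝ) + 1) * t / M))‖
          ≤ CD * (η / K * Cy + Cc * (η / K)) := by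
            rw [norm_smul, e]
            gcongr
            · exact hCD s hs'
            · refine (norm_add_le _ _).trans ?_
              rw [norm_smul, norm_smul]
              gcongr
              · exact h1 k hk _ hl s hs
              · exact hCy s hs'
              · exact hCc s hs'
              · exact h2 k hk s hs _ hr
        _ = η * (CD * (Cy + Cc) / K) := by ring
        _ ≤ η * 1 := by
            gcongr
            rw [div_le_one hK0]
            linarith
        _ = η := mul_one η)
  have hlim := (tendsto_const_nhds (x := c t • y t)).sub key
  rw [sub_zero] at hlim
  refine hlim.congr' ?_
  filter_upwards [eventually_gt_atTop 0] with M hM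
  have hM0 : (M : ℝ) ≠ 0 := by exact_mod_cast hM.ne'
  have htel : c t • y t - v 0 = ∑ k ∈ Finset.range M,
      (c (((k : ℝ) + 1) * t / M) • y (((k : ℝ) + 1) * t / M)
        - c ((k : ℝ) * t / M) • y ((k : ℝ) * t / M)) := by
    have := Finset.sum_range_sub (fun k : ℕ => c ((k : ℝ) * t / M) • y ((k : ℝ) * t / M)) M
    push_cast at this
    rw [this, hv 0 h0, mul_comm (M : ℝ), mul_div_cancel_right₀ _ hM0]
    simp [hc0]
  rw [sub_eq_iff_eq_add'] at htel
  rw [htel, add_sub_assoc, add_right_inj, ← Finset.sum_sub_distrib]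
  refine Finset.sum_congr rfl fun k hk => ?_
  have hkM := Finset.mem_range.1 hk
  set a := (k : ℝ) * t / M with ha
  set b := ((k : ℝ) + 1) * t / M with hb
  have hab : a ≤ b := block_le ht M k
  have hva : v a = y a - ∫ x in 0..a, D x • y x := hv a (block_subset ht hkM ⟨le_rfl, hab⟩)
  have hvb : v b = y b - ∫ x in 0..b, D x • y x := hv b (block_subset ht hkM ⟨hab, le_rfl⟩)
  have hDy : Continuous fun x => D x • y x := hD.smul hy
  have hDc : Continuous fun x => D x * c x := hD.mul hcc
  have hint : ∫ x in a..b, D x • (c a • y x - c x • y b)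
      = c a • (∫ x in a..b, D x • y x) + (c b - c a) • y b := by
    rw [hcI, ← intervalIntegral.integral_smul, ← intervalIntegral.integral_smul_const,
      ← intervalIntegral.integral_add]
    · refine intervalIntegral.integral_congr fun x _ => ?_
      module
    · exact (hDy.const_smul (c a)).intervalIntegrable _ _
    · exact (hDc.neg.smul continuous_const).intervalIntegrable _ _
  have hadd := intervalIntegral.integral_add_adjacent_intervals
    (hDy.intervalIntegrable (μ := volume) 0 a) (hDy.intervalIntegrable a b)
  rw [hint, hva, hvb, ← hadd]
  change _ = c a • _
  module

variable {Ω : Type*} {mΩ : MeasurableSpace Ω} {P : Measure Ω}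

theorem continuous_comp_projIcc {F : Type*} [TopologicalSpace F] {t : ℝ} (ht : 0 ≤ t) {f : ℝ → F}
    (hf : ContinuousOn f (Icc 0 t)) : Continuous fun x => f (projIcc 0 t ht x) :=
  hf.comp_continuous (continuous_subtype_val.comp continuous_projIcc) fun x => (projIcc 0 t ht x).2

/-- With `c = exp(-∫ D)`, the variation-of-constants sums converge pathwise to `c t • Y t`. Their
characteristic functions are explicit and contain Riemann sums of `∫ c² ε`. -/
theorem GaussianIncrements.integral_exp_of_linear [IsProbabilityMeasure P] {m : ℕ} {t : ℝ≥0}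
    {ε : ℝ → ℝ} {q : E m → ℝ} {V : ℝ≥0 → Ω → E m} (h : GaussianIncrements P t ε q V)
    (hq : ∀ (c : ℝ) u, q (c • u) = c ^ 2 * q u) (hε : ContinuousOn ε (Icc 0 t)) {D : ℝ → ℝ}
    (hD : ContinuousOn D (Icc 0 t)) {Y : ℝ≥0 → Ω → E m}
    (hYc : ∀ᵐ ω ∂P, ContinuousOn (fun s => Y s ω) (Icc 0 t))
    (hY : ∀ᵐ ω ∂P, ∀ s ≤ t, V s ω = Y s ω - ∫ x in (0 : ℝ)..s, D x • Y x.toNNReal ω)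
    (u : E m) :
    ∫ ω, Complex.exp ((⟪Y t ω, u⟫ : ℝ) * Complex.I) ∂P
      = Complex.exp ((-(q u * (Real.exp (2 * ∫ s in (0 : ℝ)..t, D s) * (1 + 2 *
          ∫ s in (0 : ℝ)..t, Real.exp (-2 * ∫ x in (0 : ℝ)..s, D x) * ε s)) / 2) : ℝ)) := by
  have ht : (0 : ℝ) ≤ t := t.2
  -- Clamping time to `[0, t]` makes the coefficient continuous on the whole line without changing
  -- its integrals over `[0, t]`.
  set D' : ℝ → ℝ := fun x => D (projIcc 0 (t : ℝ) ht x) with hD'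
  have hD'c : Continuous D' := continuous_comp_projIcc ht hD
  have hDD' : ∀ s ∈ Icc 0 (t : ℝ), ∫ x in 0..s, D' x = ∫ x in 0..s, D x := fun s hs => by
    refine intervalIntegral.integral_congr fun x hx => ?_
    rw [uIcc_of_le hs.1] at hx
    simp only [hD']
    rw [projIcc_of_mem ht ⟨hx.1, hx.2.trans hs.2⟩]
  set c : ℝ → ℝ := fun s => Real.exp (-∫ x in 0..s, D' x) with hc
  have hcc : Continuous c :=
    Real.continuous_exp.comp
      (intervalIntegral.continuous_primitive (fun a b => hD'c.intervalIntegrable a b) 0).neg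
  have hct : c t ≠ 0 := (Real.exp_pos _).ne'
  -- This normalisation makes the limit `⟪c t • Y t, u'⟫` equal to `⟪Y t, u⟫`; by homogeneity of `q`
  -- it produces the factor `exp(2 ∫ D)` in the variance.
  set u' : E m := (c t)⁻¹ • u with hu'
  have hlim1 : Tendsto (fun M : ℕ => ∫ ω, Complex.exp ((⟪V 0 ω, u'⟫ + ∑ k ∈ Finset.range M,
      ⟪V (((k : ℝ≥0) + 1) * t / M) ω - V ((k : ℝ≥0) * t / M) ω, c ((k : ℝ) * t / M) • u'⟫ : ℝ)
        * Complex.I) ∂P) atTop (𝓝 (∫ ω, Complex.exp ((⟪Y t ω, u⟫ : ℝ) * Complex.I) ∂P)) := by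
    refine tendsto_integral_filter_of_dominated_convergence (fun _ => (1 : ℝ)) ?_ ?_
      (integrable_const _) ?_
    · filter_upwards [eventually_gt_atTop 0] with M hM
      have hM' : (0 : ℝ≥0) < M := by exact_mod_cast hM
      have hgrid : ∀ k ≤ M, AEMeasurable (V ((k : ℝ≥0) * t / M)) P := fun k hk => by
        refine h.aemeasurable _ ?_
        rw [div_le_iff₀ hM', mul_comm t]
        gcongr
      have h1 : AEMeasurable (fun ω => ⟪V 0 ω, u'⟫ + ∑ k ∈ Finset.range M,
          ⟪V (((k : ℝ≥0) + 1) * t / M) ω - V ((k : ℝ≥0) * t / M) ω,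
            c ((k : ℝ) * t / M) • u'⟫) P := by
        refine ((h.aemeasurable 0 zero_le).inner aemeasurable_const).add
          (Finset.aemeasurable_fun_sum _ fun k hk => ?_)
        have hk' := Finset.mem_range.1 hk
        have h2 := hgrid (k + 1) hk'
        push_cast at h2
        exact (h2.sub (hgrid k hk'.le)).inner aemeasurable_const
      have h6 : Measurable fun x : ℝ => Complex.exp (x * Complex.I) := by fun_prop
      exact (h6.comp_aemeasurable h1).aestronglyMeasurable
    · exact Eventually.of_forall fun M => ae_of_all _ fun ω => by
        rw [Complex.norm_exp_ofReal_mul_I]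
    · filter_upwards [hYc, hY] with ω hω hωV
      set y : ℝ → E m := fun x => Y (projIcc 0 (t : ℝ) ht x : ℝ).toNNReal ω with hy
      have hyc : Continuous y := by
        refine continuous_comp_projIcc ht (f := fun x => Y x.toNNReal ω) ?_
        refine hω.comp continuous_real_toNNReal.continuousOn fun x hx => ?_
        exact ⟨zero_le, Real.toNNReal_le_iff_le_coe.2 hx.2⟩
      have hyY : ∀ s ∈ Icc 0 (t : ℝ), y s = Y s.toNNReal ω := fun s hs => by
        simp only [hy]
        rw [projIcc_of_mem ht hs]
      have hv : ∀ s ∈ Icc 0 (t : ℝ), V s.toNNReal ω = y s - ∫ x in 0..s, D' x • y x :=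
        fun s hs => by
          rw [hωV _ (Real.toNNReal_le_iff_le_coe.2 hs.2), hyY s hs, Real.coe_toNNReal _ hs.1]
          congr 1
          refine intervalIntegral.integral_congr fun x hx => ?_
          rw [uIcc_of_le hs.1] at hx
          have hx' : x ∈ Icc 0 (t : ℝ) := ⟨hx.1, hx.2.trans hs.2⟩
          simp only [hyY x hx', hD']
          rw [projIcc_of_mem ht hx']
      have hT := tendsto_sum_exp_smul_increments ht hD'c hyc hv
      have hT' := hT.inner (𝕜 := ℝ) (tendsto_const_nhds (x := u'))
      have e1 : ⟪Real.exp (-∫ x in 0..(t : ℝ), D' x) • y t, u'⟫ = ⟪Y t ω, u⟫ := by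
        rw [hyY t ⟨ht, le_rfl⟩, Real.toNNReal_coe, hu', real_inner_smul_left,
          real_inner_smul_right, ← mul_assoc, mul_inv_cancel₀ hct, one_mul]
      rw [e1] at hT'
      refine (Complex.continuous_exp.tendsto _).comp
        ((Complex.continuous_ofReal.tendsto _).comp (hT'.congr fun M => ?_) |>.mul_const _)
      have hnn : ∀ k : ℕ, ((k : ℝ) * t / M).toNNReal = (k : ℝ≥0) * t / M := fun k => by
        apply NNReal.coe_injective
        rw [Real.coe_toNNReal _ (by positivity)]
        push_cast
        rfl
      rw [inner_add_left, sum_inner, Real.toNNReal_zero]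
      congr 1
      refine Finset.sum_congr rfl fun k _ => ?_
      have h2 := hnn (k + 1)
      push_cast at h2
      rw [hnn, h2, real_inner_smul_left, real_inner_smul_right _ u' (c ((k : ℝ) * t / M))]
  have hlim2 : Tendsto (fun M : ℕ => ∫ ω, Complex.exp ((⟪V 0 ω, u'⟫ + ∑ k ∈ Finset.range M,
      ⟪V (((k : ℝ≥0) + 1) * t / M) ω - V ((k : ℝ≥0) * t / M) ω, c ((k : ℝ) * t / M) • u'⟫ : ℝ)
        * Complex.I) ∂P) atTop (𝓝 (Complex.exp ((-(q u' / 2 +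
          q u' * ∫ x in 0..(t : ℝ), c x ^ 2 * ε x) : ℝ)))) := by
    have h1 : Tendsto (fun M : ℕ => Complex.exp ((-(q u' / 2 + q u' * ∑ k ∈ Finset.range M,
        c ((k : ℝ) * t / M) ^ 2 *
          ∫ x in ((k : ℝ) * t / M)..(((k : ℝ) + 1) * t / M), ε x) : ℝ))) atTop
        (𝓝 (Complex.exp ((-(q u' / 2 + q u' * ∫ x in 0..(t : ℝ), c x ^ 2 * ε x) : ℝ)))) := by
      refine (Complex.continuous_exp.tendsto _).comp ((Complex.continuous_ofReal.tendsto _).comp ?_)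
      exact (tendsto_const_nhds.add ((tendsto_sum_mul_integral_blocks ht
        (hcc.pow 2).continuousOn hε).const_mul _)).neg
    refine h1.congr' ?_
    filter_upwards [eventually_gt_atTop 0] with M hM
    rw [h.integral_exp M hM]
    congr 4
    rw [Finset.mul_sum]
    refine Finset.sum_congr rfl fun k _ => ?_
    rw [hq (c ((k : ℝ) * t / M)) u']
    ring
  rw [tendsto_nhds_unique hlim1 hlim2]
  congr 2
  have hI : ∫ x in 0..(t : ℝ), c x ^ 2 * ε x
      = ∫ s in (0 : ℝ)..t, Real.exp (-2 * ∫ x in (0 : ℝ)..s, D x) * ε s := by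
    refine intervalIntegral.integral_congr fun s hs => ?_
    rw [uIcc_of_le ht] at hs
    simp only [hc]
    rw [hDD' s hs, ← Real.exp_nat_mul]
    congr 2
    push_cast
    ring
  have hq' : q u' = q u * Real.exp (2 * ∫ s in (0 : ℝ)..t, D s) := by
    rw [hu', hq, mul_comm]
    congr 1
    simp only [hc]
    rw [hDD' t ⟨ht, le_rfl⟩, ← Real.exp_neg, neg_neg, ← Real.exp_nat_mul]
    congr 1
  rw [hI, hq']
  ring

end Linear

/-! ### Path space: a solution is a measurable function of the noise that drives it -/

section PathSpace

variable {m : ℕ} {t : ℝ≥0}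

/-- The value of the path `z` at the real time `x`, clamped to `[0, t]`. -/
noncomputable def pathAt (z : C(Icc (0 : ℝ≥0) t, E m)) (x : ℝ) : E m :=
  z (projIcc 0 t zero_le x.toNNReal)

theorem continuous_pathAt (z : C(Icc (0 : ℝ≥0) t, E m)) : Continuous (pathAt z) :=
  z.continuous.comp (continuous_projIcc.comp continuous_real_toNNReal)

theorem norm_pathAt_le (z : C(Icc (0 : ℝ≥0) t, E m)) (x : ℝ) : ‖pathAt z x‖ ≤ ‖z‖ :=
  z.norm_coe_le_norm _

theorem pathAt_coe (z : C(Icc (0 : ℝ≥0) t, E m)) (s : Icc (0 : ℝ≥0) t) :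
    pathAt z (s : ℝ≥0) = z s := by
  rw [pathAt, Real.toNNReal_coe, projIcc_val]

/-- A drift on `[0, t]` that is integrable along continuous paths, and locally Lipschitz in space
uniformly in time. -/
structure AdmissibleDrift (t : ℝ≥0) (g : ℝ → E m → E m) : Prop where
  integrable : ∀ z : C(Icc (0 : ℝ≥0) t, E m),
    IntervalIntegrable (fun x => g x (pathAt z x)) volume 0 t
  lipschitz : ∀ R : ℝ, ∃ K : ℝ≥0, ∀ x ∈ Icc 0 (t : ℝ), ∀ y y' : E m, ‖y‖ ≤ R → ‖y'‖ ≤ R →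
    ‖g x y - g x y'‖ ≤ K * ‖y - y'‖

theorem admissibleDrift_zero : AdmissibleDrift t (fun _ (_ : E m) => 0) where
  integrable _ := by simp
  lipschitz _ := ⟨0, by simp⟩

/-- What remains of the path `z` at rational fractions of `t` once the drift is subtracted. -/
noncomputable def residual (g : ℝ → E m → E m) (z : C(Icc (0 : ℝ≥0) t, E m)) (a : ℚ) : E m :=
  z ⟨ratTime t a, zero_le, ratTime_le t a⟩ - ∫ x in (0 : ℝ)..ratTime t a, g x (pathAt z x)

theorem denseRange_ratTime (t : ℝ≥0) :
    DenseRange fun a : ℚ => (⟨ratTime t a, zero_le, ratTime_le t a⟩ : Icc (0 : ℝ≥0) t) := by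
  have hle : ∀ x : ℝ, min x.toNNReal 1 * t ≤ t := fun x =>
    mul_le_of_le_one_left' (min_le_right _ _)
  set f : ℝ → Icc (0 : ℝ≥0) t := fun x => ⟨min x.toNNReal 1 * t, zero_le, hle x⟩ with hf
  have hfc : Continuous f := by
    refine Continuous.subtype_mk ?_ _
    exact (continuous_real_toNNReal.min continuous_const).mul continuous_const
  have hfs : Function.Surjective f := by
    rintro ⟨s, hs0, hs⟩
    refine ⟨((s / t : ℝ≥0) : ℝ), Subtype.ext ?_⟩
    simp only [hf, Real.toNNReal_coe]
    rcases eq_or_ne t 0 with rfl | ht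
    · simpa using (le_antisymm hs zero_le).symm
    · rw [min_eq_left (div_le_one_of_le₀ hs zero_le), div_mul_cancel₀ _ ht]
  exact hfs.denseRange.comp Rat.denseRange_cast hfc

/-- Grönwall's inequality is applied to the primitive of `f`, whose derivative `f` is at most `K`
times the primitive itself. -/
theorem eq_zero_of_le_integral {T K : ℝ} {f : ℝ → ℝ} (hf : Continuous f)
    (hf0 : ∀ x, 0 ≤ f x) (h : ∀ x ∈ Icc 0 T, f x ≤ K * ∫ y in 0..x, f y) :
    ∀ x ∈ Icc 0 T, f x = 0 := by
  have hd : ∀ x, HasDerivAt (fun x => ∫ y in 0..x, f y) (f x) x := fun x =>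
    (hf.integral_hasStrictDerivAt 0 x).hasDerivAt
  have hI : ∀ x ∈ Icc 0 T, ‖∫ y in 0..x, f y‖ ≤ gronwallBound 0 K 0 (x - 0) := by
    refine norm_le_gronwallBound_of_norm_deriv_right_le
      (fun x _ => (hd x).continuousAt.continuousWithinAt)
      (fun x _ => (hd x).hasDerivWithinAt) (by simp) fun x hx => ?_
    have hx0 : 0 ≤ ∫ y in 0..x, f y :=
      intervalIntegral.integral_nonneg hx.1 fun y _ => hf0 y
    rw [Real.norm_of_nonneg (hf0 x), Real.norm_of_nonneg hx0, add_zero]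
    exact h x (Ico_subset_Icc_self hx)
  intro x hx
  have := hI x hx
  rw [gronwallBound_ε0_δ0, norm_le_zero_iff] at this
  refine le_antisymm ?_ (hf0 x)
  simpa [this] using h x hx

/-- Equal residuals at the dense rational times are equal at all times by continuity. The distance
between the two paths is then bounded by a constant times its own integral, with a Lipschitz
constant taken on a ball containing both paths. -/
theorem injective_residual {g : ℝ → E m → E m} (hg : AdmissibleDrift t g) :
    Function.Injective (residual (t := t) g) := by
  intro z z' hzz'
  have ht : (0 : ℝ) ≤ t := t.2
  have hcont : ∀ z : C(Icc (0 : ℝ≥0) t, E m), Continuous fun s : Icc (0 : ℝ≥0) t =>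
      z s - ∫ x in (0 : ℝ)..(s : ℝ≥0), g x (pathAt z x) := fun z => by
    refine z.continuous.sub ?_
    have h1 := intervalIntegral.continuousOn_primitive_interval' (hg.integrable z)
      (a := 0) left_mem_uIcc
    rw [uIcc_of_le ht] at h1
    refine h1.comp_continuous (f := fun s : Icc (0 : ℝ≥0) t => ((s : ℝ≥0) : ℝ)) ?_ fun s => ?_
    · exact NNReal.continuous_coe.comp continuous_subtype_val
    · exact ⟨(s : ℝ≥0).2, by exact_mod_cast s.2.2⟩
  have heq := (denseRange_ratTime t).equalizer (hcont z) (hcont z')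
    (funext fun a => congrFun hzz' a)
  obtain ⟨K, hK⟩ := hg.lipschitz (max ‖z‖ ‖z'‖)
  have hδ : ∀ x ∈ Icc 0 (t : ℝ), ‖pathAt z x - pathAt z' x‖ = 0 := by
    refine eq_zero_of_le_integral (K := K)
      ((continuous_pathAt z).sub (continuous_pathAt z')).norm (fun x => norm_nonneg _) ?_
    intro x hx
    have hxt : x.toNNReal ∈ Icc 0 t := ⟨zero_le, Real.toNNReal_le_iff_le_coe.2 hx.2⟩
    have hx' := congrFun heq ⟨x.toNNReal, hxt⟩
    simp only at hx'
    have e : ∀ z : C(Icc (0 : ℝ≥0) t, E m), pathAt z x = z ⟨x.toNNReal, hxt⟩ := fun z => by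
      rw [pathAt, projIcc_of_mem _ hxt]
    rw [Real.coe_toNNReal _ hx.1, ← e, ← e, sub_eq_sub_iff_sub_eq_sub] at hx'
    have hsub : uIcc 0 x ⊆ uIcc 0 (t : ℝ) := by
      rw [uIcc_of_le hx.1, uIcc_of_le ht]
      exact Icc_subset_Icc_right hx.2
    rw [hx', ← intervalIntegral.integral_sub ((hg.integrable z).mono_set hsub)
      ((hg.integrable z').mono_set hsub), ← intervalIntegral.integral_const_mul]
    refine intervalIntegral.norm_integral_le_of_norm_le hx.1 (ae_of_all _ fun y hy => ?_) ?_
    · exact hK y ⟨hy.1.le, hy.2.trans hx.2⟩ _ _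
        ((norm_pathAt_le z y).trans (le_max_left _ _))
        ((norm_pathAt_le z' y).trans (le_max_right _ _))
    · exact (continuous_const.mul
        ((continuous_pathAt z).sub (continuous_pathAt z')).norm).intervalIntegrable _ _
  ext1 s
  have := hδ ((s : ℝ≥0) : ℝ) ⟨(s : ℝ≥0).2, by exact_mod_cast s.2.2⟩
  rwa [pathAt_coe, pathAt_coe, norm_sub_eq_zero_iff] at this

/-- Dominated convergence: paths uniformly close to `z₀` stay in the ball of radius `‖z₀‖ + 1`,
where the Lipschitz bound compares the drift with its value along the zero path, which is
integrable. -/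
theorem continuous_residual {g : ℝ → E m → E m} (hg : AdmissibleDrift t g) :
    Continuous (residual (t := t) g) := by
  have ht : (0 : ℝ) ≤ t := t.2
  refine continuous_pi fun a => ?_
  refine (continuous_eval_const _).sub ?_
  rw [continuous_iff_continuousAt]
  intro z₀
  have hs0 : (0 : ℝ) ≤ ratTime t a := (ratTime t a).2
  have hst : (ratTime t a : ℝ) ≤ t := by exact_mod_cast ratTime_le t a
  have hsub : uIcc 0 (ratTime t a : ℝ) ⊆ uIcc 0 (t : ℝ) := by
    rw [uIcc_of_le hs0, uIcc_of_le ht]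
    exact Icc_subset_Icc_right hst
  have hpath0 : ∀ x, pathAt (0 : C(Icc (0 : ℝ≥0) t, E m)) x = 0 := fun x => rfl
  obtain ⟨K, hK⟩ := hg.lipschitz (‖z₀‖ + 1)
  have hball : ∀ᶠ z in 𝓝 z₀, ‖z‖ ≤ ‖z₀‖ + 1 := by
    filter_upwards [Metric.ball_mem_nhds z₀ one_pos] with z hz
    rw [mem_ball_iff_norm] at hz
    linarith [norm_le_norm_add_norm_sub' z z₀]
  refine intervalIntegral.continuousAt_of_dominated_interval
    (bound := fun x => ‖g x 0‖ + K * (‖z₀‖ + 1)) ?_ ?_ ?_ ?_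
  · exact Eventually.of_forall fun z =>
      ((hg.integrable z).mono_set hsub).def'.aestronglyMeasurable
  · filter_upwards [hball] with z hz
    refine ae_of_all _ fun x hx => ?_
    rw [uIoc_of_le hs0] at hx
    have h1 := hK x ⟨hx.1.le, hx.2.trans hst⟩ (pathAt z x) 0 ((norm_pathAt_le z x).trans hz)
      (by simp only [norm_zero]; positivity)
    rw [sub_zero] at h1
    calc ‖g x (pathAt z x)‖ ≤ ‖g x 0‖ + ‖g x (pathAt z x) - g x 0‖ :=
          norm_le_norm_add_norm_sub' _ _
      _ ≤ ‖g x 0‖ + K * (‖z₀‖ + 1) := by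
          gcongr
          refine h1.trans ?_
          gcongr
          exact (norm_pathAt_le z x).trans hz
  · have := ((hg.integrable 0).mono_set hsub).norm
    simp only [hpath0] at this
    exact this.add (by simp)
  · refine ae_of_all _ fun x hx => ?_
    rw [uIoc_of_le hs0] at hx
    have hlip : LipschitzOnWith K (g x) (Metric.closedBall 0 (‖z₀‖ + 1)) := by
      refine LipschitzOnWith.of_dist_le_mul fun y hy y' hy' => ?_
      rw [dist_eq_norm, dist_eq_norm]
      rw [mem_closedBall_zero_iff] at hy hy'
      exact hK x ⟨hx.1.le, hx.2.trans hst⟩ y y' hy hy'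
    have hg' : ContinuousAt (g x) (pathAt z₀ x) := by
      refine hlip.continuousOn.continuousAt ?_
      refine Filter.mem_of_superset (Metric.ball_mem_nhds _ one_pos) fun y hy => ?_
      rw [mem_ball_iff_norm] at hy
      rw [mem_closedBall_zero_iff]
      linarith [norm_le_norm_add_norm_sub' y (pathAt z₀ x), norm_pathAt_le z₀ x]
    exact ContinuousAt.comp (f := fun z : C(Icc (0 : ℝ≥0) t, E m) => pathAt z x) hg'
      (continuous_eval_const _).continuousAt

local instance : MeasurableSpace C(Icc (0 : ℝ≥0) t, E m) := borel _

local instance : BorelSpace C(Icc (0 : ℝ≥0) t, E m) := ⟨rfl⟩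

/-- Lusin–Souslin: a continuous injection of the Polish path space has a measurable inverse on its
measurable image. The driving noise thus determines the path measurably, although no solution map is
constructed. -/
theorem measurableEmbedding_residual {g : ℝ → E m → E m} (hg : AdmissibleDrift t g) :
    MeasurableEmbedding (residual (t := t) g) :=
  (continuous_residual hg).measurableEmbedding (injective_residual hg)

variable {Ω : Type*} {mΩ : MeasurableSpace Ω} {P : Measure Ω}

/-- Paths are continuous only almost surely, so the zero path is substituted on a measurable null
set containing the exceptional one. -/
theorem exists_measurable_path {X : ℝ≥0 → Ω → E m} (hXm : ∀ s ≤ t, Measurable (X s))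
    (hXc : ∀ᵐ ω ∂P, ContinuousOn (fun s => X s ω) (Icc 0 t)) :
    ∃ Z : Ω → C(Icc (0 : ℝ≥0) t, E m), Measurable Z ∧
      ∀ᵐ ω ∂P, ∀ s : Icc (0 : ℝ≥0) t, Z ω s = X s ω := by
  classical
  obtain ⟨A, hA, hAm, hA0⟩ := exists_measurable_superset_of_null (ae_iff.1 hXc)
  have hc : ∀ ω, ω ∉ A → Continuous fun s : Icc (0 : ℝ≥0) t => X s ω := fun ω hω => by
    have : ContinuousOn (fun s => X s ω) (Icc 0 t) := by
      by_contra h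
      exact hω (hA h)
    exact continuousOn_iff_continuous_domRestrict.1 this
  set Z : Ω → C(Icc (0 : ℝ≥0) t, E m) := fun ω =>
    if h : ω ∈ A then 0 else ⟨fun s => X s ω, hc ω h⟩ with hZ
  have hZs : ∀ ω s, Z ω s = Aᶜ.indicator (X s) ω := fun ω s => by
    by_cases h : ω ∈ A
    · simp [hZ, h]
    · simp [hZ, h]
  refine ⟨Z, ?_, ?_⟩
  -- For zero drift the residual is evaluation at rational times, so the embedding reduces
  -- measurability into path space to measurability of these coordinates.
  · rw [← (measurableEmbedding_residual (admissibleDrift_zero (m := m))).measurable_comp_iff,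
      measurable_pi_iff]
    intro a
    have : (fun ω => (residual (fun _ _ => 0) ∘ Z) ω a) = Aᶜ.indicator (X (ratTime t a)) := by
      ext1 ω
      simp [residual, hZs]
    rw [this]
    exact (hXm _ (ratTime_le t a)).indicator hAm.compl
  · have hA' : ∀ᵐ ω ∂P, ω ∉ A := by
      rw [ae_iff]
      simpa using hA0
    filter_upwards [hA'] with ω hω s
    simp [hZs, hω]

theorem residual_eq_noisePart {g : ℝ → E m → E m} {X : ℝ≥0 → Ω → E m} {ω : Ω}
    {z : C(Icc (0 : ℝ≥0) t, E m)} (hz : ∀ s : Icc (0 : ℝ≥0) t, z s = X s ω) (a : ℚ) :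
    residual g z a = noisePart g X (ratTime t a) ω := by
  rw [residual, noisePart, hz]
  congr 1
  refine intervalIntegral.integral_congr fun x hx => ?_
  have h0 : (0 : ℝ) ≤ ratTime t a := (ratTime t a).2
  rw [uIcc_of_le h0] at hx
  have hx' : x.toNNReal ∈ Icc 0 t :=
    ⟨zero_le, (Real.toNNReal_le_iff_le_coe.2 hx.2).trans (ratTime_le t a)⟩
  simp only [pathAt]
  rw [projIcc_of_mem _ hx', hz]

/-- Processes are independent if the noises driving them are. -/
theorem indepFun_of_indepFun_noisePart {m₁ m₂ : ℕ} {g₁ : ℝ → E m₁ → E m₁} {g₂ : ℝ → E m₂ → E m₂}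
    (hg₁ : AdmissibleDrift t g₁) (hg₂ : AdmissibleDrift t g₂) {Y : ℝ≥0 → Ω → E m₁}
    {Z : ℝ≥0 → Ω → E m₂} (hYm : ∀ s ≤ t, Measurable (Y s)) (hZm : ∀ s ≤ t, Measurable (Z s))
    (hYc : ∀ᵐ ω ∂P, ContinuousOn (fun s => Y s ω) (Icc 0 t))
    (hZc : ∀ᵐ ω ∂P, ContinuousOn (fun s => Z s ω) (Icc 0 t))
    (h : IndepFun (fun ω (a : ℚ) => noisePart g₁ Y (ratTime t a) ω)
      (fun ω (a : ℚ) => noisePart g₂ Z (ratTime t a) ω) P) :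
    IndepFun (fun ω (s : Icc (0 : ℝ≥0) t) => Y s ω) (fun ω (s : Icc (0 : ℝ≥0) t) => Z s ω) P := by
  obtain ⟨Y', hY'm, hY'⟩ := exists_measurable_path hYm hYc
  obtain ⟨Z', hZ'm, hZ'⟩ := exists_measurable_path hZm hZc
  have h1 : IndepFun (fun ω => residual g₁ (Y' ω)) (fun ω => residual g₂ (Z' ω)) P := by
    refine h.congr ?_ ?_
    · filter_upwards [hY'] with ω hω
      exact funext fun a => (residual_eq_noisePart hω a).symm
    · filter_upwards [hZ'] with ω hω
      exact funext fun a => (residual_eq_noisePart hω a).symm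
  have h2 : IndepFun Y' Z' P := by
    rw [IndepFun_iff_Indep] at h1 ⊢
    -- An embedding loses no information: composing with it leaves the generated σ-algebra
    -- unchanged.
    have e₁ : MeasurableSpace.comap (fun ω => residual g₁ (Y' ω)) inferInstance
        = MeasurableSpace.comap Y' inferInstance := by
      rw [← (measurableEmbedding_residual hg₁).comap_eq, MeasurableSpace.comap_comp]
      rfl
    have e₂ : MeasurableSpace.comap (fun ω => residual g₂ (Z' ω)) inferInstance
        = MeasurableSpace.comap Z' inferInstance := by
      rw [← (measurableEmbedding_residual hg₂).comap_eq, MeasurableSpace.comap_comp]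
      rfl
    rwa [e₁, e₂] at h1
  have hev : ∀ k : ℕ, Measurable fun (z : C(Icc (0 : ℝ≥0) t, E k)) (s : Icc (0 : ℝ≥0) t) => z s :=
    fun k => measurable_pi_lambda _ fun s => (continuous_eval_const s).measurable
  refine (h2.comp (hev m₁) (hev m₂)).congr ?_ ?_
  · filter_upwards [hY'] with ω hω
    exact funext hω
  · filter_upwards [hZ'] with ω hω
    exact funext hω

/-- Uniqueness in law for equations with additive noise. -/
theorem map_eq_of_map_noisePart_eq {Ω' : Type*} {mΩ' : MeasurableSpace Ω'} {P' : Measure Ω'}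
    {g : ℝ → E m → E m} (hg : AdmissibleDrift t g) {Z : ℝ≥0 → Ω → E m} {Z' : ℝ≥0 → Ω' → E m}
    (hZm : ∀ s ≤ t, Measurable (Z s)) (hZm' : ∀ s ≤ t, Measurable (Z' s))
    (hZc : ∀ᵐ ω ∂P, ContinuousOn (fun s => Z s ω) (Icc 0 t))
    (hZc' : ∀ᵐ ω ∂P', ContinuousOn (fun s => Z' s ω) (Icc 0 t))
    (h : P.map (fun ω (a : ℚ) => noisePart g Z (ratTime t a) ω)
      = P'.map (fun ω (a : ℚ) => noisePart g Z' (ratTime t a) ω)) :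
    P.map (Z t) = P'.map (Z' t) := by
  obtain ⟨z, hzm, hz⟩ := exists_measurable_path hZm hZc
  obtain ⟨z', hzm', hz'⟩ := exists_measurable_path hZm' hZc'
  have hemb := measurableEmbedding_residual (t := t) hg
  have h1 : (P.map z).map (residual g) = (P'.map z').map (residual g) := by
    rw [Measure.map_map hemb.measurable hzm, Measure.map_map hemb.measurable hzm']
    have e : (residual g ∘ z) =ᵐ[P] fun ω (a : ℚ) => noisePart g Z (ratTime t a) ω := by
      filter_upwards [hz] with ω hω
      exact funext fun a => residual_eq_noisePart hω a
    have e' : (residual g ∘ z') =ᵐ[P'] fun ω (a : ℚ) => noisePart g Z' (ratTime t a) ω := by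
      filter_upwards [hz'] with ω hω
      exact funext fun a => residual_eq_noisePart hω a
    rw [Measure.map_congr e, Measure.map_congr e', h]
  have h2 : P.map z = P'.map z' := by
    rw [← hemb.comap_map (P.map z), h1, hemb.comap_map]
  have hev : Measurable fun z : C(Icc (0 : ℝ≥0) t, E m) => z ⟨t, zero_le, le_rfl⟩ :=
    (continuous_eval_const _).measurable
  have e : Z t =ᵐ[P] (fun z : C(Icc (0 : ℝ≥0) t, E m) => z ⟨t, zero_le, le_rfl⟩) ∘ z := by
    filter_upwards [hz] with ω hω
    exact (hω ⟨t, zero_le, le_rfl⟩).symm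
  have e' : Z' t =ᵐ[P'] (fun z : C(Icc (0 : ℝ≥0) t, E m) => z ⟨t, zero_le, le_rfl⟩) ∘ z' := by
    filter_upwards [hz'] with ω hω
    exact (hω ⟨t, zero_le, le_rfl⟩).symm
  rw [Measure.map_congr e, Measure.map_congr e', ← Measure.map_map hev hzm, h2,
    Measure.map_map hev hzm']

end PathSpace

/-! ### Linear algebra of the hidden projection -/

section Algebra

theorem exists_linearMap_comp_eq {V V₁ V₂ : Type*} [AddCommGroup V] [Module ℝ V]
    [AddCommGroup V₁] [Module ℝ V₁] [AddCommGroup V₂] [Module ℝ V₂] (f : V →ₗ[ℝ] V₁)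
    (g : V →ₗ[ℝ] V₂) (h : ∀ x, f x = 0 → g x = 0) : ∃ l : V₁ →ₗ[ℝ] V₂, ∀ x, l (f x) = g x := by
  obtain ⟨s, hs⟩ := f.rangeRestrict.exists_rightInverse_of_surjective f.range_rangeRestrict
  obtain ⟨l, hl⟩ := LinearMap.exists_extend (g ∘ₗ s)
  refine ⟨l, fun x => ?_⟩
  have h1 : l (f x) = g (s (f.rangeRestrict x)) := LinearMap.congr_fun hl (f.rangeRestrict x)
  have h2 : f (s (f.rangeRestrict x)) = f x :=
    congrArg Subtype.val (LinearMap.congr_fun hs (f.rangeRestrict x))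
  rw [h1, ← sub_eq_zero, ← map_sub]
  exact h _ (by rw [map_sub, h2, sub_self])

theorem charFun_multivariateGaussian_zero {n : ℕ} {S : Matrix (Fin n) (Fin n) ℝ}
    (hS : S.PosSemidef) (u : E n) :
    charFun (multivariateGaussian 0 S) u
      = Complex.exp ((-(⟪u, Matrix.toEuclideanLin S u⟫ / 2) : ℝ)) := by
  rw [charFun_multivariateGaussian hS]
  have : ⟪u, Matrix.toEuclideanLin S u⟫ = u.ofLp ⬝ᵥ S.mulVec u.ofLp := by
    rw [EuclideanSpace.inner_eq_star_dotProduct, dotProduct_comm]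
    simp
  rw [this]
  simp

variable {d r : ℕ} (w : Matrix (Fin d) (Fin r) ℝ)

/-- The hidden projection as a continuous linear map. -/
noncomputable def hiddenCLM : E d →L[ℝ] E r :=
  LinearMap.toContinuousLinearMap ((√(d : ℝ))⁻¹ • Matrix.toEuclideanLin w.transpose)

theorem hiddenCLM_apply (x : E d) : hiddenCLM w x = hiddenProj w x := rfl

theorem adjoint_hiddenCLM (u : E r) :
    ContinuousLinearMap.adjoint (hiddenCLM w) u = (√(d : ℝ))⁻¹ • Matrix.toEuclideanLin w u := by
  refine ext_inner_left ℝ fun x => ?_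
  rw [ContinuousLinearMap.adjoint_inner_right, hiddenCLM_apply, hiddenProj, real_inner_smul_left,
    real_inner_smul_right, inner_toEuclideanLin_left, Matrix.transpose_transpose]

theorem toEuclideanLin_overlap (u : E r) : Matrix.toEuclideanLin (overlap w) u
    = hiddenProj w ((√(d : ℝ))⁻¹ • Matrix.toEuclideanLin w u) := by
  have h : (√(d : ℝ))⁻¹ * (√(d : ℝ))⁻¹ = (d : ℝ)⁻¹ := by
    rw [← mul_inv, Real.mul_self_sqrt (Nat.cast_nonneg d)]
  rw [hiddenProj, overlap, map_smul, map_smul, smul_smul, h, LinearMap.smul_apply]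
  congr 1
  ext i
  simp [Matrix.toLpLin_apply]

theorem inner_overlap (u : E r) : ⟪u, Matrix.toEuclideanLin (overlap w) u⟫
    = ‖ContinuousLinearMap.adjoint (hiddenCLM w) u‖ ^ 2 := by
  rw [toEuclideanLin_overlap, ← adjoint_hiddenCLM, ← hiddenCLM_apply,
    ← ContinuousLinearMap.adjoint_inner_left, real_inner_self_eq_norm_sq]

theorem overlap_posSemidef : (overlap w).PosSemidef := by
  have := (Matrix.posSemidef_conjTranspose_mul_self w).smul
    (inv_nonneg.2 (Nat.cast_nonneg (α := ℝ) d))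
  rwa [Matrix.conjTranspose_eq_transpose_of_trivial] at this

theorem charFun_overlap (u : E r) : charFun (multivariateGaussian 0 (overlap w)) u
    = Complex.exp ((-(‖ContinuousLinearMap.adjoint (hiddenCLM w) u‖ ^ 2 / 2) : ℝ)) := by
  rw [charFun_multivariateGaussian_zero (overlap_posSemidef w), inner_overlap]

theorem transpose_sqrt (Q : Matrix (Fin r) (Fin r) ℝ) :
    (CFC.sqrt Q).transpose = CFC.sqrt Q := by
  have : (CFC.sqrt Q).PosSemidef := Matrix.nonneg_iff_posSemidef.1 (CFC.sqrt_nonneg Q)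
  rw [← Matrix.conjTranspose_eq_transpose_of_trivial]
  exact this.isHermitian

theorem norm_sq_sqrt_overlap (u : E r) :
    ‖Matrix.toEuclideanLin (CFC.sqrt (overlap w)).transpose u‖ ^ 2
      = ‖ContinuousLinearMap.adjoint (hiddenCLM w) u‖ ^ 2 := by
  have hsq : CFC.sqrt (overlap w) * CFC.sqrt (overlap w) = overlap w :=
    CFC.sqrt_mul_sqrt_self _ (Matrix.nonneg_iff_posSemidef.2 (overlap_posSemidef w))
  rw [← inner_overlap, ← real_inner_self_eq_norm_sq, transpose_sqrt, inner_toEuclideanLin_left,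
    transpose_sqrt]
  congr 1
  conv_rhs => rw [← hsq]
  ext i
  simp [Matrix.toLpLin_apply]

theorem toEuclideanLin_mem_colSpace (u : E r) : Matrix.toEuclideanLin w u ∈ colSpace w := by
  have : Matrix.toEuclideanLin w u = ∑ j, u j • (WithLp.toLp 2 (w.col j) : E d) := by
    ext i
    simp [Matrix.toLpLin_apply, Matrix.mulVec, dotProduct, mul_comm]
  rw [this]
  exact Submodule.sum_mem _ fun j _ => Submodule.smul_mem _ _ (Submodule.subset_span ⟨j, rfl⟩)

theorem perp_toEuclideanLin (u : E r) : perp w (Matrix.toEuclideanLin w u) = 0 := by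
  rw [perp, Submodule.starProjection_apply_eq_zero_iff]
  exact Submodule.le_orthogonal_orthogonal _ (toEuclideanLin_mem_colSpace w u)

theorem adjoint_perp : ContinuousLinearMap.adjoint (perp w) = perp w :=
  (isSelfAdjoint_starProjection _).adjoint_eq

theorem perp_perp (x : E d) : perp w (perp w x) = perp w x := by
  have := Submodule.isIdempotentElem_starProjection (colSpace w)ᗮ
  exact congrArg (fun f : E d →L[ℝ] E d => f x) this

theorem inner_perp_self (x : E d) : ⟪x, perp w x⟫ = ‖perp w x‖ ^ 2 := by
  rw [← real_inner_self_eq_norm_sq, ← ContinuousLinearMap.adjoint_inner_right, adjoint_perp,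
    perp_perp]

/-- The adjoint of `hiddenCLM` maps into the column space of `w` and that of `perp` into its
orthogonal complement. This Pythagorean identity is the source of the independence of `Y` and `Z`.
-/
theorem norm_sq_perp_add_hidden (a : E d) (c : E r) :
    ‖ContinuousLinearMap.adjoint (perp w) a + ContinuousLinearMap.adjoint (hiddenCLM w) c‖ ^ 2
      = ‖ContinuousLinearMap.adjoint (perp w) a‖ ^ 2
        + ‖ContinuousLinearMap.adjoint (hiddenCLM w) c‖ ^ 2 := by
  have h : ⟪ContinuousLinearMap.adjoint (perp w) a,
      ContinuousLinearMap.adjoint (hiddenCLM w) c⟫ = 0 := by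
    rw [ContinuousLinearMap.adjoint_inner_left, adjoint_hiddenCLM, map_smul, perp_toEuclideanLin,
      smul_zero, inner_zero_right]
  rw [sq, sq, sq, norm_add_sq_eq_norm_sq_add_norm_sq_real h]

/-- A vector killed by `wᵀ` is orthogonal to every column of `w`, so the projection onto the column
space factors through `hiddenProj`. Positivity of `d` keeps the scaling factor nonzero. -/
theorem exists_lift_hiddenProj (hd : 0 < d) :
    ∃ L : E r →L[ℝ] E d, ∀ x, L (hiddenProj w x) = (colSpace w).starProjection x := by
  obtain ⟨l, hl⟩ := exists_linearMap_comp_eq (hiddenCLM w : E d →ₗ[ℝ] E r)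
    ((colSpace w).starProjection : E d →ₗ[ℝ] E d) (fun x hx => by
      have hd' : (√(d : ℝ))⁻¹ ≠ 0 := by positivity
      have hx' : Matrix.toEuclideanLin w.transpose x = 0 := (smul_eq_zero.1 hx).resolve_left hd'
      change (colSpace w).starProjection x = 0
      rw [Submodule.starProjection_apply_eq_zero_iff, colSpace, Submodule.mem_orthogonal]
      intro y hy
      induction hy using Submodule.span_induction with
      | mem y hy =>
        obtain ⟨j, rfl⟩ := hy
        have := congrFun (congrArg WithLp.ofLp hx') j
        rw [EuclideanSpace.inner_eq_star_dotProduct, dotProduct_comm]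
        simp only [Matrix.toLpLin_apply, Matrix.mulVec, star_trivial] at this ⊢
        exact this
      | zero => exact inner_zero_left _
      | add y z _ _ hy hz => rw [inner_add_left, hy, hz, add_zero]
      | smul a y _ hy => rw [real_inner_smul_left, hy, mul_zero])
  exact ⟨LinearMap.toContinuousLinearMap l, hl⟩

/-- A polar decomposition of the hidden projection along `𝒬^{1/2}`. -/
theorem exists_polar_factor : ∃ (A : E d →L[ℝ] E r) (C : E r →L[ℝ] E r),
    (∀ x, Matrix.toEuclideanLin (CFC.sqrt (overlap w)) (A x) = hiddenProj w x) ∧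
    (∀ x, Matrix.toEuclideanLin (CFC.sqrt (overlap w)) (C x) = 0) ∧
    ∀ u, ‖ContinuousLinearMap.adjoint A u‖ ^ 2 + ‖ContinuousLinearMap.adjoint C u‖ ^ 2
      = ‖u‖ ^ 2 := by
  set S : E r →ₗ[ℝ] E r := Matrix.toEuclideanLin (CFC.sqrt (overlap w)) with hS
  have hSsymm : ∀ x y, ⟪S x, y⟫ = ⟪x, S y⟫ := fun x y => by
    rw [hS, inner_toEuclideanLin_left, transpose_sqrt]
  have hSnorm : ∀ u, ‖S u‖ ^ 2 = ‖ContinuousLinearMap.adjoint (hiddenCLM w) u‖ ^ 2 := fun u => by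
    rw [← norm_sq_sqrt_overlap, transpose_sqrt]
  obtain ⟨l, hl⟩ := exists_linearMap_comp_eq S
    (ContinuousLinearMap.adjoint (hiddenCLM w) : E r →ₗ[ℝ] E d) (fun x hx => by
      have := hSnorm x
      rw [hx, norm_zero, zero_pow two_ne_zero, eq_comm, sq_eq_zero_iff, norm_eq_zero] at this
      exact this)
  -- `D` is the adjoint of the polar factor: it sends `S y` to the adjoint hidden projection of `y`
  -- and vanishes on the complement of `S.range`. Since `hSnorm` makes it isometric on that range,
  -- the projection onto the complement supplies the missing part of the identity.
  set D : E r →L[ℝ] E d := (LinearMap.toContinuousLinearMap l).comp S.range.starProjection with hD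
  have hDS : ∀ y, D (S y) = ContinuousLinearMap.adjoint (hiddenCLM w) y := fun y => by
    have : S.range.starProjection (S y) = S y :=
      Submodule.starProjection_eq_self_iff.2 (LinearMap.mem_range_self S y)
    rw [hD, ContinuousLinearMap.comp_apply, this]
    exact hl y
  refine ⟨ContinuousLinearMap.adjoint D, S.rangeᗮ.starProjection, fun x => ?_, fun x => ?_,
    fun u => ?_⟩
  · refine ext_inner_right ℝ fun y => ?_
    rw [hSsymm, ContinuousLinearMap.adjoint_inner_left, hDS,
      ContinuousLinearMap.adjoint_inner_right, hiddenCLM_apply]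
  · refine ext_inner_right ℝ fun y => ?_
    rw [hSsymm, inner_zero_left, real_inner_comm]
    exact Submodule.inner_right_of_mem_orthogonal (LinearMap.mem_range_self S y)
      (Submodule.starProjection_apply_mem _ x)
  · rw [ContinuousLinearMap.adjoint_adjoint,
      (isSelfAdjoint_starProjection (S.rangeᗮ)).adjoint_eq]
    have h1 : ‖D u‖ = ‖S.range.starProjection u‖ := by
      obtain ⟨y, hy⟩ := LinearMap.mem_range.1 (Submodule.starProjection_apply_mem S.range u)
      have h2 : D u = ContinuousLinearMap.adjoint (hiddenCLM w) y := by
        rw [hD, ContinuousLinearMap.comp_apply, ← hy]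
        exact hl y
      have h3 := hSnorm y
      rw [h2, ← hy]
      exact (sq_eq_sq₀ (norm_nonneg _) (norm_nonneg _)).1 h3.symm
    rw [h1]
    exact (Submodule.norm_sq_eq_add_norm_sq_starProjection u S.range).symm

/-- Independent columns make `𝒬^{1/2}` injective. As it annihilates the range of `C`, the
complementary factor is zero. -/
theorem exists_coisometric_polar_factor (hd : 0 < d) (hw : LinearIndependent ℝ w.col) :
    ∃ A : E d →L[ℝ] E r,
    (∀ x, Matrix.toEuclideanLin (CFC.sqrt (overlap w)) (A x) = hiddenProj w x) ∧
    ∀ u, ‖ContinuousLinearMap.adjoint A u‖ ^ 2 = ‖u‖ ^ 2 := by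
  obtain ⟨A, C, hA, hC, hAC⟩ := exists_polar_factor w
  have hinj : ∀ u, Matrix.toEuclideanLin (CFC.sqrt (overlap w)) u = 0 → u = 0 := fun u hu => by
    have h1 := norm_sq_sqrt_overlap w u
    have hd' : (√(d : ℝ))⁻¹ ≠ 0 := by positivity
    rw [transpose_sqrt, hu, norm_zero, zero_pow two_ne_zero, eq_comm, sq_eq_zero_iff, norm_eq_zero,
      adjoint_hiddenCLM, smul_eq_zero] at h1
    have h2 := congrArg WithLp.ofLp (h1.resolve_left hd')
    rw [Matrix.toLpLin_apply] at h2
    have h3 := Matrix.mulVec_injective_iff.2 hw (a₁ := u.ofLp) (a₂ := 0) (by simpa using h2)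
    ext i
    exact congrFun h3 i
  have hC0 : C = 0 := by
    ext1 x
    exact hinj _ (hC x)
  refine ⟨A, hA, fun u => ?_⟩
  rw [← hAC u, hC0]
  simp

end Algebra

/-! ### Wiener processes on product spaces -/

section Wiener

variable {Ω Ω' : Type*} {mΩ : MeasurableSpace Ω} {mΩ' : MeasurableSpace Ω'}
  {P : Measure Ω} {P' : Measure Ω'}

theorem charFun_map_clm {m n : ℕ} (A : E n →L[ℝ] E m) {X : Ω → E n} (hX : AEMeasurable X P)
    (u : E m) : charFun (P.map fun ω => A (X ω)) u
      = charFun (P.map X) (ContinuousLinearMap.adjoint A u) := by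
  have hAX : AEMeasurable (fun ω => A (X ω)) P := A.continuous.measurable.comp_aemeasurable hX
  rw [charFun_apply, charFun_apply, integral_map hX (by fun_prop),
    integral_map hAX (by fun_prop)]
  simp_rw [ContinuousLinearMap.adjoint_inner_right]

theorem hasLaw_of_charFun_eq [IsProbabilityMeasure P] {n : ℕ} {X : Ω → E n}
    (hX : AEMeasurable X P) {μ : Measure (E n)} [IsFiniteMeasure μ]
    (h : ∀ u, charFun (P.map X) u = charFun μ u) : HasLaw X μ P where
  aemeasurable := hX
  map_eq := by
    have := Measure.isProbabilityMeasure_map hX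
    exact Measure.ext_of_charFun (funext h)

theorem IsWienerProcess.measurable {n : ℕ} {𝓕 : Filtration ℝ≥0 mΩ} {B : ℝ≥0 → Ω → E n}
    (hB : IsWienerProcess P 𝓕 B) (t : ℝ≥0) : Measurable (B t) :=
  (hB.adapted t).mono (𝓕.le t) le_rfl

theorem IsWienerProcess.charFun_increment {n : ℕ} {𝓕 : Filtration ℝ≥0 mΩ} {B : ℝ≥0 → Ω → E n}
    (hB : IsWienerProcess P 𝓕 B) {s t : ℝ≥0} (hst : s ≤ t) (u : E n) :
    charFun (P.map fun ω => B t ω - B s ω) u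
      = Complex.exp ((-(‖u‖ ^ 2 * ((t : ℝ) - s) / 2) : ℝ)) := by
  rw [(hB.increment_law s t hst).map_eq,
    charFun_multivariateGaussian_smul_one (sub_nonneg.2 (by exact_mod_cast hst))]

theorem hasLaw_increment_of_charFun [IsProbabilityMeasure P] {n : ℕ} {X : Ω → E n}
    (hX : AEMeasurable X P) {s t : ℝ≥0} (hst : s ≤ t)
    (h : ∀ u, charFun (P.map X) u = Complex.exp ((-(‖u‖ ^ 2 * ((t : ℝ) - s) / 2) : ℝ))) :
    HasLaw X (multivariateGaussian 0 (((t : ℝ) - s) • (1 : Matrix (Fin n) (Fin n) ℝ))) P :=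
  hasLaw_of_charFun_eq hX fun u => by
    rw [h, charFun_multivariateGaussian_smul_one (sub_nonneg.2 (by exact_mod_cast hst))]

theorem IsWienerProcess.comp_clm [IsProbabilityMeasure P] {m n : ℕ} {𝓕 : Filtration ℝ≥0 mΩ}
    {B : ℝ≥0 → Ω → E n} (hB : IsWienerProcess P 𝓕 B) (A : E n →L[ℝ] E m)
    (hA : ∀ u, ‖ContinuousLinearMap.adjoint A u‖ ^ 2 = ‖u‖ ^ 2) :
    IsWienerProcess P 𝓕 fun t ω => A (B t ω) where
  adapted t := A.continuous.measurable.comp (hB.adapted t)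
  start_zero := by
    filter_upwards [hB.start_zero] with ω hω
    rw [hω, map_zero]
  continuous_paths := by
    filter_upwards [hB.continuous_paths] with ω hω
    exact A.continuous.comp hω
  increment_law s t hst := by
    have hm : Measurable fun ω => B t ω - B s ω := (hB.measurable t).sub (hB.measurable s)
    simp_rw [← map_sub]
    have hAm : Measurable fun ω => A (B t ω - B s ω) := A.continuous.measurable.comp hm
    refine hasLaw_increment_of_charFun hAm.aemeasurable hst fun u => ?_
    rw [charFun_map_clm A hm.aemeasurable, hB.charFun_increment hst, hA]
  increment_indep s t hst := by
    simp_rw [← map_sub]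
    refine indep_of_indep_of_le_right (hB.increment_indep s t hst) ?_
    exact (A.continuous.measurable.comp (comap_measurable _)).comap_le

/-- Rectangles form a π-system generating the product σ-algebra, and on them the product measure
factors. -/
theorem indep_prod {Ω Ω' : Type*} {m₁ n₁ mΩ : MeasurableSpace Ω} {m₂ n₂ mΩ' : MeasurableSpace Ω'}
    {P : Measure Ω} {P' : Measure Ω'} [IsProbabilityMeasure P] [IsProbabilityMeasure P']
    (hm₁ : m₁ ≤ mΩ) (hn₁ : n₁ ≤ mΩ) (hm₂ : m₂ ≤ mΩ') (hn₂ : n₂ ≤ mΩ')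
    (h₁ : Indep m₁ n₁ P) (h₂ : Indep m₂ n₂ P') :
    Indep (m₁.prod m₂) (n₁.prod n₂) (P.prod P') := by
  refine IndepSets.indep (sup_le_sup (MeasurableSpace.comap_mono hm₁)
    (MeasurableSpace.comap_mono hm₂)) (sup_le_sup (MeasurableSpace.comap_mono hn₁)
    (MeasurableSpace.comap_mono hn₂)) (@isPiSystem_prod _ _ m₁ m₂) (@isPiSystem_prod _ _ n₁ n₂)
    (@generateFrom_prod _ _ m₁ m₂).symm (@generateFrom_prod _ _ n₁ n₂).symm ?_
  rw [IndepSets_iff]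
  rintro _ _ ⟨a, ha, b, hb, rfl⟩ ⟨a', ha', b', hb', rfl⟩
  rw [Indep_iff] at h₁ h₂
  rw [prod_inter_prod, Measure.prod_prod, Measure.prod_prod, Measure.prod_prod, h₁ a a' ha ha',
    h₂ b b' hb hb']
  ring

theorem pi_mono {ι Ω : Type*} {m m' : MeasurableSpace Ω} (h : m ≤ m') :
    @MeasurableSpace.pi ι (fun _ => Ω) (fun _ => m)
      ≤ @MeasurableSpace.pi ι (fun _ => Ω) (fun _ => m') :=
  iSup_mono fun _ => MeasurableSpace.comap_mono h

theorem indep_pi {ι Ω : Type*} [Fintype ι] {m n mΩ : MeasurableSpace Ω} {P : Measure Ω}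
    [IsProbabilityMeasure P]
    (hm : m ≤ mΩ) (hn : n ≤ mΩ) (h : Indep m n P) :
    Indep (@MeasurableSpace.pi ι (fun _ => Ω) (fun _ => m))
      (@MeasurableSpace.pi ι (fun _ => Ω) (fun _ => n)) (Measure.pi fun _ : ι => P) := by
  refine IndepSets.indep (pi_mono hm) (pi_mono hn) (@isPiSystem_pi ι (fun _ => Ω) (fun _ => m))
    (@isPiSystem_pi ι (fun _ => Ω) (fun _ => n))
    (@generateFrom_pi ι (fun _ => Ω) _ (fun _ => m)).symm
    (@generateFrom_pi ι (fun _ => Ω) _ (fun _ => n)).symm ?_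
  rw [IndepSets_iff]
  rintro _ _ ⟨a, ha, rfl⟩ ⟨b, hb, rfl⟩
  rw [Indep_iff] at h
  rw [← pi_inter_distrib, Measure.pi_pi, Measure.pi_pi, Measure.pi_pi, ← Finset.prod_mul_distrib]
  exact Finset.prod_congr rfl fun i _ => h _ _ (ha i (mem_univ i)) (hb i (mem_univ i))

/-- The product of two filtrations. -/
def prodFiltration (𝓕 : Filtration ℝ≥0 mΩ) (𝓖 : Filtration ℝ≥0 mΩ') :
    Filtration ℝ≥0 (inferInstance : MeasurableSpace (Ω × Ω')) where
  seq t := (𝓕 t).prod (𝓖 t)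
  mono' _ _ h := sup_le_sup (MeasurableSpace.comap_mono (𝓕.mono h))
    (MeasurableSpace.comap_mono (𝓖.mono h))
  le' t := sup_le_sup (MeasurableSpace.comap_mono (𝓕.le t)) (MeasurableSpace.comap_mono (𝓖.le t))

/-- The product of copies of a filtration. -/
def piFiltration (ι : Type*) (𝓕 : Filtration ℝ≥0 mΩ) :
    Filtration ℝ≥0 (inferInstance : MeasurableSpace (ι → Ω)) where
  seq t := @MeasurableSpace.pi ι (fun _ => Ω) (fun _ => 𝓕 t)
  mono' _ _ h := pi_mono (𝓕.mono h)
  le' t := pi_mono (𝓕.le t)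

theorem IsWienerProcess.hasLaw_pi_increment [IsProbabilityMeasure P] {d r : ℕ}
    {𝓕 : Filtration ℝ≥0 mΩ} {B : ℝ≥0 → Ω → E d} (hB : IsWienerProcess P 𝓕 B) (i : Fin d)
    {s t : ℝ≥0} (hst : s ≤ t) :
    HasLaw (fun ω : Fin r → Ω => (WithLp.toLp 2 fun j => B t (ω j) i : E r)
        - (WithLp.toLp 2 fun j => B s (ω j) i : E r))
      (multivariateGaussian 0 (((t : ℝ) - s) • (1 : Matrix (Fin r) (Fin r) ℝ)))
      (Measure.pi fun _ : Fin r => P) := by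
  have hm : ∀ t, Measurable fun ω => B t ω i := fun t =>
    (show Measurable fun x : E d => x i by fun_prop).comp (hB.measurable t)
  have hm' : ∀ t, Measurable fun ω : Fin r → Ω =>
      (WithLp.toLp 2 fun j => B t (ω j) i : E r) := fun t =>
    (PiLp.continuous_toLp 2 _).measurable.comp
      (measurable_pi_lambda _ fun j => (hm t).comp (measurable_pi_apply j))
  have hΔ : Measurable fun ω => B t ω - B s ω := (hB.measurable t).sub (hB.measurable s)
  have hmΔ : Measurable fun ω : Fin r → Ω => (WithLp.toLp 2 fun j => B t (ω j) i : E r)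
      - (WithLp.toLp 2 fun j => B s (ω j) i : E r) := (hm' t).sub (hm' s)
  refine hasLaw_increment_of_charFun hmΔ.aemeasurable hst fun u => ?_
  rw [charFun_apply, integral_map hmΔ.aemeasurable (by fun_prop)]
  -- Only coordinate `i` is used in each copy, so the inner product splits over independent copies,
  -- each tested against a multiple of the `i`-th basis vector.
  have e : ∀ ω : Fin r → Ω, Complex.exp ((⟪(WithLp.toLp 2 fun j => B t (ω j) i : E r)
      - (WithLp.toLp 2 fun j => B s (ω j) i : E r), u⟫ : ℝ) * Complex.I)
      = ∏ j, Complex.exp ((⟪B t (ω j) - B s (ω j), EuclideanSpace.single i (u j)⟫ : ℝ)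
        * Complex.I) := fun ω => by
    rw [← Complex.exp_sum, ← Finset.sum_mul, ← Complex.ofReal_sum]
    congr 3
    rw [PiLp.inner_apply]
    refine Finset.sum_congr rfl fun j _ => ?_
    rw [EuclideanSpace.inner_single_right]
    simp
  rw [integral_congr_ae (ae_of_all _ e), integral_fintype_prod_eq_prod (fun j ω => Complex.exp
    ((⟪B t ω - B s ω, EuclideanSpace.single i (u j)⟫ : ℝ) * Complex.I))]
  have e2 : ∀ j, ∫ ω, Complex.exp
      ((⟪B t ω - B s ω, EuclideanSpace.single i (u j)⟫ : ℝ) * Complex.I) ∂P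
      = Complex.exp ((-((u j) ^ 2 * ((t : ℝ) - s) / 2) : ℝ)) := fun j => by
    have := hB.charFun_increment hst (EuclideanSpace.single i (u j))
    rw [charFun_apply, integral_map hΔ.aemeasurable (by fun_prop)] at this
    rw [this]
    simp
  simp_rw [e2]
  rw [← Complex.exp_sum, ← Complex.ofReal_sum, EuclideanSpace.real_norm_sq_eq,
    Finset.sum_neg_distrib, Finset.sum_mul, Finset.sum_div]

theorem IsWienerProcess.indep_pi_increment [IsProbabilityMeasure P] {d r : ℕ}
    {𝓕 : Filtration ℝ≥0 mΩ} {B : ℝ≥0 → Ω → E d} (hB : IsWienerProcess P 𝓕 B) (i : Fin d)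
    {s t : ℝ≥0} (hst : s ≤ t) :
    Indep (piFiltration (Fin r) 𝓕 s) (MeasurableSpace.comap
      (fun ω : Fin r → Ω => (WithLp.toLp 2 fun j => B t (ω j) i : E r)
        - (WithLp.toLp 2 fun j => B s (ω j) i : E r)) inferInstance)
      (Measure.pi fun _ : Fin r => P) := by
  have hΔ : Measurable fun ω => B t ω - B s ω := (hB.measurable t).sub (hB.measurable s)
  refine indep_of_indep_of_le_right
    (indep_pi (𝓕.le s) hΔ.comap_le (hB.increment_indep s t hst)) ?_
  rw [← measurable_iff_comap_le]
  set mc := MeasurableSpace.comap (fun ω => B t ω - B s ω) inferInstance with hmc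
  have h1 : Measurable[mc] fun ω => B t ω i - B s ω i :=
    (show Measurable fun x : E d => x i by fun_prop).comp (comap_measurable _)
  refine (PiLp.continuous_toLp 2 _).measurable.comp
    (@measurable_pi_lambda _ _ _ (@MeasurableSpace.pi (Fin r) (fun _ => Ω) (fun _ => mc)) _ _
      fun j => ?_)
  exact h1.comp (@measurable_pi_apply (Fin r) (fun _ => Ω) (fun _ => mc) j)

/-- Independent copies of one coordinate of a Wiener process form a Wiener process. -/
theorem IsWienerProcess.pi [IsProbabilityMeasure P] {d r : ℕ} {𝓕 : Filtration ℝ≥0 mΩ}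
    {B : ℝ≥0 → Ω → E d} (hB : IsWienerProcess P 𝓕 B) (i : Fin d) :
    IsWienerProcess (Measure.pi fun _ : Fin r => P) (piFiltration (Fin r) 𝓕)
      (fun t ω => (WithLp.toLp 2 fun j => B t (ω j) i : E r)) where
  adapted t := by
    refine (PiLp.continuous_toLp 2 _).measurable.comp ?_
    refine @measurable_pi_lambda _ _ _ ((piFiltration (Fin r) 𝓕) t) _ _ fun j => ?_
    have h1 : Measurable[𝓕 t] fun ω => B t ω i :=
      (show Measurable fun x : E d => x i by fun_prop).comp (hB.adapted t)
    exact h1.comp (@measurable_pi_apply (Fin r) (fun _ => Ω) (fun _ => 𝓕 t) j)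
  start_zero := by
    have : ∀ᵐ ω ∂(Measure.pi fun _ : Fin r => P), ∀ j, B 0 (ω j) = 0 := ae_all_iff.2 fun j =>
      (measurePreserving_eval (fun _ : Fin r => P) j).quasiMeasurePreserving.ae hB.start_zero
    filter_upwards [this] with ω hω
    ext j
    simp [hω]
  continuous_paths := by
    have : ∀ᵐ ω ∂(Measure.pi fun _ : Fin r => P), ∀ j, Continuous fun t => B t (ω j) :=
      ae_all_iff.2 fun j =>
        (measurePreserving_eval (fun _ : Fin r => P) j).quasiMeasurePreserving.ae
          hB.continuous_paths
    filter_upwards [this] with ω hω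
    refine (PiLp.continuous_toLp 2 _).comp (continuous_pi fun j => ?_)
    exact (show Continuous fun x : E d => x i by fun_prop).comp (hω j)
  increment_law _ _ hst := hB.hasLaw_pi_increment i hst
  increment_indep _ _ hst := hB.indep_pi_increment i hst

theorem IsWienerProcess.hasLaw_prod_increment [IsProbabilityMeasure P] [IsProbabilityMeasure P']
    {d k r : ℕ} {𝓕 : Filtration ℝ≥0 mΩ} {𝓖 : Filtration ℝ≥0 mΩ'} {B : ℝ≥0 → Ω → E d}
    {B' : ℝ≥0 → Ω' → E k} (hB : IsWienerProcess P 𝓕 B) (hB' : IsWienerProcess P' 𝓖 B')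
    (A : E d →L[ℝ] E r) (C : E k →L[ℝ] E r) (hAC : ∀ u, ‖ContinuousLinearMap.adjoint A u‖ ^ 2
      + ‖ContinuousLinearMap.adjoint C u‖ ^ 2 = ‖u‖ ^ 2) {s t : ℝ≥0} (hst : s ≤ t) :
    HasLaw (fun ω : Ω × Ω' => A (B t ω.1) + C (B' t ω.2) - (A (B s ω.1) + C (B' s ω.2)))
      (multivariateGaussian 0 (((t : ℝ) - s) • (1 : Matrix (Fin r) (Fin r) ℝ))) (P.prod P') := by
  have hΔ : Measurable fun ω => B t ω - B s ω := (hB.measurable t).sub (hB.measurable s)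
  have hΔ' : Measurable fun ω => B' t ω - B' s ω := (hB'.measurable t).sub (hB'.measurable s)
  have e0 : (fun ω : Ω × Ω' => A (B t ω.1) + C (B' t ω.2) - (A (B s ω.1) + C (B' s ω.2)))
      = fun ω => A (B t ω.1 - B s ω.1) + C (B' t ω.2 - B' s ω.2) := by
    ext1 ω
    rw [map_sub, map_sub]
    abel
  rw [e0]
  have hm : Measurable fun ω : Ω × Ω' => A (B t ω.1 - B s ω.1) + C (B' t ω.2 - B' s ω.2) :=
    ((A.continuous.measurable.comp hΔ).comp measurable_fst).add
      ((C.continuous.measurable.comp hΔ').comp measurable_snd)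
  refine hasLaw_increment_of_charFun hm.aemeasurable hst fun u => ?_
  rw [charFun_apply, integral_map hm.aemeasurable (by fun_prop)]
  have e : ∀ ω : Ω × Ω', Complex.exp
      ((⟪A (B t ω.1 - B s ω.1) + C (B' t ω.2 - B' s ω.2), u⟫ : ℝ) * Complex.I)
      = Complex.exp ((⟪B t ω.1 - B s ω.1, ContinuousLinearMap.adjoint A u⟫ : ℝ) * Complex.I)
        * Complex.exp ((⟪B' t ω.2 - B' s ω.2, ContinuousLinearMap.adjoint C u⟫ : ℝ)
          * Complex.I) := fun ω => by
    rw [← Complex.exp_add, inner_add_left, ContinuousLinearMap.adjoint_inner_right,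
      ContinuousLinearMap.adjoint_inner_right]
    push_cast
    ring_nf
  simp_rw [e]
  rw [integral_prod_mul (fun ω => Complex.exp
      ((⟪B t ω - B s ω, ContinuousLinearMap.adjoint A u⟫ : ℝ) * Complex.I))
    (fun ω => Complex.exp
      ((⟪B' t ω - B' s ω, ContinuousLinearMap.adjoint C u⟫ : ℝ) * Complex.I))]
  have e1 := hB.charFun_increment hst (ContinuousLinearMap.adjoint A u)
  have e2 := hB'.charFun_increment hst (ContinuousLinearMap.adjoint C u)
  rw [charFun_apply, integral_map hΔ.aemeasurable (by fun_prop)] at e1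
  rw [charFun_apply, integral_map hΔ'.aemeasurable (by fun_prop)] at e2
  rw [e1, e2, ← Complex.exp_add, ← hAC u]
  push_cast
  ring_nf

theorem IsWienerProcess.indep_prod_increment [IsProbabilityMeasure P] [IsProbabilityMeasure P']
    {d k r : ℕ} {𝓕 : Filtration ℝ≥0 mΩ} {𝓖 : Filtration ℝ≥0 mΩ'} {B : ℝ≥0 → Ω → E d}
    {B' : ℝ≥0 → Ω' → E k} (hB : IsWienerProcess P 𝓕 B) (hB' : IsWienerProcess P' 𝓖 B')
    (A : E d →L[ℝ] E r) (C : E k →L[ℝ] E r) {s t : ℝ≥0} (hst : s ≤ t) :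
    Indep (prodFiltration 𝓕 𝓖 s) (MeasurableSpace.comap
      (fun ω : Ω × Ω' => A (B t ω.1) + C (B' t ω.2) - (A (B s ω.1) + C (B' s ω.2))) inferInstance)
      (P.prod P') := by
  have hΔ : Measurable fun ω => B t ω - B s ω := (hB.measurable t).sub (hB.measurable s)
  have hΔ' : Measurable fun ω => B' t ω - B' s ω := (hB'.measurable t).sub (hB'.measurable s)
  refine indep_of_indep_of_le_right (indep_prod (𝓕.le s) hΔ.comap_le (𝓖.le s) hΔ'.comap_le
    (hB.increment_indep s t hst) (hB'.increment_indep s t hst)) ?_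
  rw [← measurable_iff_comap_le]
  set mc := MeasurableSpace.comap (fun ω => B t ω - B s ω) inferInstance with hmc
  set mc' := MeasurableSpace.comap (fun ω => B' t ω - B' s ω) inferInstance with hmc'
  have h1 : Measurable[mc.prod mc'] fun ω : Ω × Ω' => A (B t ω.1 - B s ω.1) :=
    (A.continuous.measurable.comp (comap_measurable fun ω => B t ω - B s ω)).comp
      (@measurable_fst _ _ mc mc')
  have h2 : Measurable[mc.prod mc'] fun ω : Ω × Ω' => C (B' t ω.2 - B' s ω.2) :=
    (C.continuous.measurable.comp (comap_measurable fun ω => B' t ω - B' s ω)).comp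
      (@measurable_snd _ _ mc mc')
  have e0 : (fun ω : Ω × Ω' => A (B t ω.1) + C (B' t ω.2) - (A (B s ω.1) + C (B' s ω.2)))
      = fun ω => A (B t ω.1 - B s ω.1) + C (B' t ω.2 - B' s ω.2) := by
    ext1 ω
    rw [map_sub, map_sub]
    abel
  rw [e0]
  exact h1.add h2

/-- The hypothesis `hAC` says `A Aᵀ + C Cᵀ = 1`, which is what makes the increment covariances add
up to the identity. -/
theorem IsWienerProcess.prod_add [IsProbabilityMeasure P] [IsProbabilityMeasure P'] {d k r : ℕ}
    {𝓕 : Filtration ℝ≥0 mΩ} {𝓖 : Filtration ℝ≥0 mΩ'} {B : ℝ≥0 → Ω → E d} {B' : ℝ≥0 → Ω' → E k}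
    (hB : IsWienerProcess P 𝓕 B) (hB' : IsWienerProcess P' 𝓖 B') (A : E d →L[ℝ] E r)
    (C : E k →L[ℝ] E r) (hAC : ∀ u, ‖ContinuousLinearMap.adjoint A u‖ ^ 2
      + ‖ContinuousLinearMap.adjoint C u‖ ^ 2 = ‖u‖ ^ 2) :
    IsWienerProcess (P.prod P') (prodFiltration 𝓕 𝓖)
      (fun t ω => A (B t ω.1) + C (B' t ω.2)) where
  adapted t := by
    have h1 : Measurable[prodFiltration 𝓕 𝓖 t] fun ω : Ω × Ω' => A (B t ω.1) :=
      (A.continuous.measurable.comp (hB.adapted t)).comp (@measurable_fst _ _ (𝓕 t) (𝓖 t))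
    have h2 : Measurable[prodFiltration 𝓕 𝓖 t] fun ω : Ω × Ω' => C (B' t ω.2) :=
      (C.continuous.measurable.comp (hB'.adapted t)).comp (@measurable_snd _ _ (𝓕 t) (𝓖 t))
    exact h1.add h2
  start_zero := by
    filter_upwards [Measure.quasiMeasurePreserving_fst.ae hB.start_zero,
      Measure.quasiMeasurePreserving_snd.ae hB'.start_zero] with ω h1 h2
    simp [h1, h2]
  continuous_paths := by
    filter_upwards [Measure.quasiMeasurePreserving_fst.ae hB.continuous_paths,
      Measure.quasiMeasurePreserving_snd.ae hB'.continuous_paths] with ω h1 h2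
    exact (A.continuous.comp h1).add (C.continuous.comp h2)
  increment_law _ _ hst := hB.hasLaw_prod_increment hB' A C hAC hst
  increment_indep _ _ hst := hB.indep_prod_increment hB' A C hst

end Wiener

/-! ### Images of solutions under linear maps -/

section Transport

variable {Ω Ω' : Type*} {mΩ : MeasurableSpace Ω} {mΩ' : MeasurableSpace Ω'}
  {P : Measure Ω} {P' : Measure Ω'}

theorem tendstoInMeasure_clm_comp {ι : Type*} {l : Filter ι} {m n : ℕ} {f : ι → Ω → E m}
    {g : Ω → E m} (h : TendstoInMeasure P f l g) (A : E m →L[ℝ] E n) {π : Ω' → Ω}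
    (hπ : MeasurePreserving π P' P) :
    TendstoInMeasure P' (fun i ω => A (f i (π ω))) l (fun ω => A (g (π ω))) := by
  intro η hη
  -- The added `1` gives a nonzero Lipschitz constant even when `A = 0`.
  have hK : ((‖A‖₊ + 1 : ℝ≥0) : ℝ≥0∞) ≠ ∞ := ENNReal.coe_ne_top
  refine tendsto_of_tendsto_of_tendsto_of_le_of_le tendsto_const_nhds
    (h (η / (‖A‖₊ + 1 : ℝ≥0)) (ENNReal.div_pos hη.ne' hK)) (fun _ => zero_le) fun i => ?_
  calc P' {ω | η ≤ edist (A (f i (π ω))) (A (g (π ω)))}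
      ≤ P' (π ⁻¹' {ω | η / (‖A‖₊ + 1 : ℝ≥0) ≤ edist (f i ω) (g ω)}) := by
        refine measure_mono fun ω hω => ?_
        refine ENNReal.div_le_of_le_mul' (le_trans hω ((A.lipschitz _ _).trans ?_))
        gcongr
        exact le_self_add
    _ ≤ (P'.map π) {ω | η / (‖A‖₊ + 1 : ℝ≥0) ≤ edist (f i ω) (g ω)} :=
        Measure.le_map_apply hπ.measurable.aemeasurable _
    _ = P {ω | η / (‖A‖₊ + 1 : ℝ≥0) ≤ edist (f i ω) (g ω)} := by rw [hπ.map_eq]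

theorem noisePart_map {m n : ℕ} {g : ℝ → E m → E m} {g' : ℝ → E n → E n} (A : E m →L[ℝ] E n)
    (hg : ∀ x y, A (g x y) = g' x (A y)) {X : ℝ≥0 → Ω → E m} {s : ℝ≥0} {ω : Ω}
    (h : IntervalIntegrable (fun x => g x (X x.toNNReal ω)) volume 0 s) :
    A (noisePart g X s ω) = noisePart g' (fun t ω => A (X t ω)) s ω := by
  rw [noisePart, noisePart, map_sub, ← A.intervalIntegral_comp_comm h]
  simp_rw [hg]

/-- The image of a solution under a linear map that intertwines the drifts, seen on an extension
`π` of the probability space. -/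
theorem IsSDESolution.map {m n k l : ℕ} {𝓕 : Filtration ℝ≥0 mΩ} {𝓖 : Filtration ℝ≥0 mΩ'} {T : ℝ}
    {g : ℝ → E m → E m} {g' : ℝ → E n → E n} {G : ℝ → Matrix (Fin m) (Fin k) ℝ}
    {G' : ℝ → Matrix (Fin n) (Fin l) ℝ} {W : ℝ≥0 → Ω → E k} {B : ℝ≥0 → Ω' → E l}
    {X : ℝ≥0 → Ω → E m} (hX : IsSDESolution P 𝓕 T g G W X) {π : Ω' → Ω}
    (hπ : MeasurePreserving π P' P) (hπ𝓖 : ∀ t, @Measurable _ _ (𝓖 t) (𝓕 t) π)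
    (hB : IsWienerProcess P' 𝓖 B) (A : E m →L[ℝ] E n) (hg : ∀ x y, A (g x y) = g' x (A y))
    (hG : ∀ x s t ω, A (Matrix.toEuclideanLin (G x) (W t (π ω) - W s (π ω)))
      = Matrix.toEuclideanLin (G' x) (B t ω - B s ω)) :
    IsSDESolution P' 𝓖 T g' G' B (fun t ω => A (X t (π ω))) where
  wiener := hB
  adapted t ht := (A.continuous.measurable.comp (hX.adapted t ht)).comp (hπ𝓖 t)
  continuous_paths := by
    filter_upwards [hπ.quasiMeasurePreserving.ae hX.continuous_paths] with ω hω
    exact A.continuous.comp_continuousOn hω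
  drift_integrable := by
    filter_upwards [hπ.quasiMeasurePreserving.ae hX.drift_integrable] with ω hω t ht
    simp_rw [← hg]
    have := hω t ht
    exact ⟨A.integrable_comp this.1, A.integrable_comp this.2⟩
  equation t ht := by
    have h1 := tendstoInMeasure_clm_comp (hX.equation t ht) A hπ
    have h2 : (fun N ω => A (itoSum G W t N (π ω))) = itoSum G' B t := by
      ext1 N
      ext1 ω
      simp only [itoSum, map_sum, hG]
    rw [h2] at h1
    refine h1.congr_right ?_
    filter_upwards [hπ.quasiMeasurePreserving.ae hX.drift_integrable] with ω hω
    rw [map_sub, map_sub, ← A.intervalIntegral_comp_comm (hω t ht)]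
    simp_rw [hg]

end Transport

/-! ### The generative model -/

section Model

variable {d r : ℕ} {α β ε σ p : ℝ → ℝ} {b : ℝ} {v : E r} {T : ℝ} (w : Matrix (Fin d) (Fin r) ℝ)

/-- The drift closes on `Z` because the activation sees only `hiddenProj`, and projecting its outer
factor `w / √d` produces `wᵀ w / d`. -/
theorem hiddenCLM_genDrift (x : ℝ) (y : E d) : hiddenCLM w (genDrift α β ε σ p b w v x y)
    = lowDrift α β ε σ p b (overlap w) v x (hiddenCLM w y) := by
  rw [lowDrift, toEuclideanLin_overlap, genDrift, dae, Del, ← hiddenCLM_apply, ← hiddenCLM_apply]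
  simp only [map_add, map_smul]
  rw [Gam]
  module

/-- The activation term lies in the column space of `w`, so only the skip connection and the linear
term survive. -/
theorem perp_genDrift (x : ℝ) (y : E d) :
    perp w (genDrift α β ε σ p b w v x y) = Del α β ε b x • perp w y := by
  rw [genDrift, dae, Del, Gam]
  simp only [map_add, map_smul, perp_toEuclideanLin]
  module

theorem IsSchedule.continuousOn_dot_α (hS : IsSchedule α β ε) :
    ContinuousOn (dot α) (Icc 0 1) :=
  hS.α_C2.continuousOn_derivWithin (uniqueDiffOn_Icc zero_lt_one) one_le_two

theorem IsSchedule.continuousOn_dot_β (hS : IsSchedule α β ε) :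
    ContinuousOn (dot β) (Icc 0 1) :=
  hS.β_C2.continuousOn_derivWithin (uniqueDiffOn_Icc zero_lt_one) one_le_two

theorem IsSchedule.continuousOn_ε (hS : IsSchedule α β ε) (hT1 : T ≤ 1) {t : ℝ} (ht : t < T) :
    ContinuousOn ε (Icc 0 t) :=
  hS.ε_C0.mono (Icc_subset_Icc_right (ht.le.trans hT1))

theorem IsSchedule.continuousOn_gam (hS : IsSchedule α β ε) (hT1 : T ≤ 1)
    (hα : ∀ t ∈ Ico 0 T, α t ≠ 0) {t : ℝ} (ht : t < T) :
    ContinuousOn (Gam α β ε) (Icc 0 t) := by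
  have hsub : Icc 0 t ⊆ Icc (0 : ℝ) 1 := Icc_subset_Icc_right (ht.le.trans hT1)
  have hα0 : ∀ x ∈ Icc 0 t, α x ≠ 0 := fun x hx => hα x ⟨hx.1, hx.2.trans_lt ht⟩
  have h1 := hS.continuousOn_dot_α.mono hsub
  have h2 := hS.continuousOn_dot_β.mono hsub
  have h3 := hS.α_C2.continuousOn.mono hsub
  have h4 := hS.β_C2.continuousOn.mono hsub
  have h5 := hS.ε_C0.mono hsub
  exact (h2.sub ((h1.div h3 hα0).mul h4)).add
    (h5.mul (h4.div (h3.pow 2) fun x hx => pow_ne_zero 2 (hα0 x hx)))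

theorem IsSchedule.continuousOn_del (hS : IsSchedule α β ε) (hT1 : T ≤ 1)
    (hα : ∀ t ∈ Ico 0 T, α t ≠ 0) {t : ℝ} (ht : t < T) :
    ContinuousOn (Del α β ε b) (Icc 0 t) := by
  have hsub : Icc 0 t ⊆ Icc (0 : ℝ) 1 := Icc_subset_Icc_right (ht.le.trans hT1)
  have hα0 : ∀ x ∈ Icc 0 t, α x ≠ 0 := fun x hx => hα x ⟨hx.1, hx.2.trans_lt ht⟩
  have h1 := hS.continuousOn_dot_α.mono hsub
  have h3 := hS.α_C2.continuousOn.mono hsub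
  have h5 := hS.ε_C0.mono hsub
  exact ((continuousOn_const.mul (hS.continuousOn_gam hT1 hα ht)).add (h1.div h3 hα0)).sub
    (h5.div (h3.pow 2) fun x hx => pow_ne_zero 2 (hα0 x hx))

theorem admissibleDrift_smul {m : ℕ} {t : ℝ≥0} {D : ℝ → ℝ} (hD : ContinuousOn D (Icc 0 t)) :
    AdmissibleDrift t (fun x (y : E m) => D x • y) where
  integrable z := by
    apply ContinuousOn.intervalIntegrable
    have ht : (0 : ℝ) ≤ t := t.2
    rw [uIcc_of_le ht]
    exact hD.smul (continuous_pathAt z).continuousOn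
  lipschitz R := by
    obtain ⟨C, hC⟩ := isCompact_Icc.exists_bound_of_continuousOn hD
    refine ⟨C.toNNReal, fun x hx y y' _ _ => ?_⟩
    rw [← smul_sub, norm_smul]
    gcongr
    exact (hC x hx).trans (Real.le_coe_toNNReal C)

/-- Time `0` alone gives continuity, hence the measurability needed for the drift. An index `j` is
required because the assumption is void for `r = 0`. -/
theorem LocLipActivation.continuous (hT0 : 0 < T) (hσ : LocLipActivation T σ p v) (j : Fin r) :
    Continuous σ := by
  have h1 : Continuous fun x => σ (x + p 0 * v j) := by
    rw [continuous_iff_continuousAt]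
    intro x
    obtain ⟨K, hK⟩ := hσ (|x| + 1) 0 hT0
    refine (hK 0 ⟨le_rfl, le_rfl⟩ j).continuousOn.continuousAt (Icc_mem_nhds ?_ ?_)
    · linarith [neg_abs_le x]
    · linarith [le_abs_self x]
  have h2 : σ = (fun x => σ (x + p 0 * v j)) ∘ fun x => x - p 0 * v j := by
    ext x
    simp
  rw [h2]
  exact h1.comp (by fun_prop)

theorem LocLipActivation.norm_act_sub_le {R t : ℝ} {K : ℝ≥0} (hK : ∀ s ∈ Icc 0 t, ∀ j,
    LipschitzOnWith K (fun x => σ (x + p s * v j)) (Icc (-R) R)) {x : ℝ} (hx : x ∈ Icc 0 t)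
    {y y' : E r} (hy : ‖y‖ ≤ R) (hy' : ‖y'‖ ≤ R) :
    ‖act σ p v x y - act σ p v x y'‖ ≤ K * ‖y - y'‖ := by
  have hmem : ∀ {z : E r}, ‖z‖ ≤ R → ∀ j, z j ∈ Icc (-R) R := fun {z} hz j =>
    abs_le.1 ((PiLp.norm_apply_le z j).trans hz)
  refine abs_le_of_sq_le_sq' ?_ (by positivity) |>.2
  rw [mul_pow, EuclideanSpace.real_norm_sq_eq, EuclideanSpace.real_norm_sq_eq, Finset.mul_sum]
  refine Finset.sum_le_sum fun j _ => ?_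
  have := (hK x hx j).dist_le_mul _ (hmem hy j) _ (hmem hy' j)
  rw [Real.dist_eq, Real.dist_eq] at this
  rw [← mul_pow, ← sq_abs]
  simp only [PiLp.sub_apply, act]
  calc _ ≤ (K * |y j - y' j|) ^ 2 := by gcongr
    _ = _ := by rw [mul_pow, sq_abs, mul_pow]

/-- The assumption on `σ` bounds only differences in space: with `p` unbounded, the drift along a
fixed path could fail to be integrable. One path `z` with integrable drift excludes this, since
along any other continuous path the drift differs by a bounded amount. -/
theorem admissibleDrift_lowDrift (hS : IsSchedule α β ε) (hT0 : 0 < T) (hT1 : T ≤ 1)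
    (hα : ∀ t ∈ Ico 0 T, α t ≠ 0) (hp : Measurable p) (hσ : LocLipActivation T σ p v)
    (Q : Matrix (Fin r) (Fin r) ℝ) {t : ℝ≥0} (ht : (t : ℝ) < T) {z : ℝ → E r}
    (hz : ContinuousOn z (Icc 0 t))
    (hzi : IntervalIntegrable (fun x => lowDrift α β ε σ p b Q v x (z x)) volume 0 t) :
    AdmissibleDrift t (lowDrift α β ε σ p b Q v) := by
  have ht0 : (0 : ℝ) ≤ t := t.2
  have hΓ := hS.continuousOn_gam hT1 hα ht
  have hΔ := hS.continuousOn_del (b := b) hT1 hα ht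
  set Q' : E r →L[ℝ] E r := LinearMap.toContinuousLinearMap (Matrix.toEuclideanLin Q) with hQ'
  have hlip : ∀ R : ℝ, ∃ K : ℝ≥0, ∀ x ∈ Icc 0 (t : ℝ), ∀ y y' : E r, ‖y‖ ≤ R → ‖y'‖ ≤ R →
      ‖lowDrift α β ε σ p b Q v x y - lowDrift α β ε σ p b Q v x y'‖ ≤ K * ‖y - y'‖ := by
    intro R
    obtain ⟨C, hC⟩ := isCompact_Icc.exists_bound_of_continuousOn hΓ
    obtain ⟨C', hC'⟩ := isCompact_Icc.exists_bound_of_continuousOn hΔ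
    obtain ⟨K, hK⟩ := hσ R t ht
    refine ⟨C'.toNNReal + C.toNNReal * (‖Q'‖₊ * K), fun x hx y y' hy hy' => ?_⟩
    have e : lowDrift α β ε σ p b Q v x y - lowDrift α β ε σ p b Q v x y'
        = Del α β ε b x • (y - y')
          + Gam α β ε x • Q' (act σ p v x y - act σ p v x y') := by
      rw [map_sub]
      simp only [lowDrift, hQ', LinearMap.coe_toContinuousLinearMap']
      module
    rw [e]
    refine (norm_add_le _ _).trans ?_
    rw [norm_smul, norm_smul]
    push_cast
    rw [add_mul, mul_assoc (C.toNNReal : ℝ), mul_assoc]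
    gcongr
    · exact (hC' x hx).trans (Real.le_coe_toNNReal C')
    · exact (hC x hx).trans (Real.le_coe_toNNReal C)
    · refine (Q'.le_opNorm _).trans ?_
      gcongr
      exact LocLipActivation.norm_act_sub_le hK hx hy hy'
  refine ⟨fun y => ?_, hlip⟩
  obtain ⟨C, hC⟩ := isCompact_Icc.exists_bound_of_continuousOn hz
  set R := max ‖y‖ C with hR
  obtain ⟨K, hK⟩ := hlip R
  rw [intervalIntegrable_iff_integrableOn_Ioc_of_le ht0] at hzi ⊢
  have hconst : IntegrableOn (fun _ => K * (R + R)) (Ioc 0 (t : ℝ)) volume :=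
    integrableOn_const (by simp)
  have hbound : IntegrableOn (fun x => ‖lowDrift α β ε σ p b Q v x (z x)‖ + K * (R + R))
      (Ioc 0 (t : ℝ)) volume := hzi.norm.add hconst
  refine hbound.mono' ?_ ?_
  · have hact : Measurable fun x => act σ p v x (pathAt y x) := by
      refine (PiLp.continuous_toLp 2 _).measurable.comp (measurable_pi_lambda _ fun j => ?_)
      have h1 : Measurable fun x => pathAt y x j :=
        (show Measurable fun x : E r => x j by fun_prop).comp (continuous_pathAt y).measurable
      exact (hσ.continuous hT0 j).measurable.comp (h1.add (hp.mul_const _))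
    have hΔm := (hΔ.mono Ioc_subset_Icc_self).aestronglyMeasurable (μ := volume) measurableSet_Ioc
    have hΓm := (hΓ.mono Ioc_subset_Icc_self).aestronglyMeasurable (μ := volume) measurableSet_Ioc
    exact (hΔm.smul (continuous_pathAt y).aestronglyMeasurable).add
      (hΓm.smul (Q'.continuous.measurable.comp hact).aestronglyMeasurable)
  · refine (ae_restrict_iff' measurableSet_Ioc).2 (ae_of_all _ fun x hx => ?_)
    have hx' := Ioc_subset_Icc_self hx
    have hy1 : ‖pathAt y x‖ ≤ R := (norm_pathAt_le y x).trans (le_max_left _ _)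
    have hz1 : ‖z x‖ ≤ R := (hC x hx').trans (le_max_right _ _)
    refine (norm_le_norm_add_norm_sub' _ (lowDrift α β ε σ p b Q v x (z x))).trans ?_
    gcongr
    refine (hK x hx' _ _ hy1 hz1).trans ?_
    gcongr
    exact (norm_sub_le _ _).trans (add_le_add hy1 hz1)

theorem perpVariance_nonneg (hS : IsSchedule α β ε) {t : ℝ} (ht0 : 0 ≤ t) (ht : t ≤ 1) :
    0 ≤ perpVariance α β ε b t := by
  have : 0 ≤ ∫ s in (0 : ℝ)..t, Real.exp (-2 * ∫ h in (0 : ℝ)..s, Del α β ε b h) * ε s :=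
    intervalIntegral.integral_nonneg ht0 fun s hs =>
      mul_nonneg (Real.exp_pos _).le (hS.ε_nonneg s ⟨hs.1, hs.2.trans ht⟩)
  rw [perpVariance]
  positivity

theorem charFun_perpLaw (hS : IsSchedule α β ε) {t : ℝ} (ht0 : 0 ≤ t) (ht : t ≤ 1) (u : E d) :
    charFun (perpLaw α β ε b w t) u
      = Complex.exp ((-(‖perp w u‖ ^ 2 * perpVariance α β ε b t / 2) : ℝ)) := by
  set M := (Matrix.toEuclideanCLM (n := Fin d) (𝕜 := ℝ)).symm (perp w) with hM
  have hMu (x : E d) : Matrix.toEuclideanLin M x = perp w x := by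
    rw [← Matrix.coe_toEuclideanCLM_eq_toEuclideanLin, hM]
    simp
  have hMp : M.PosSemidef := by
    refine Matrix.isPositive_toEuclideanLin_iff.1 ⟨fun x y => ?_, fun x => ?_⟩
    · rw [hMu, hMu, ← ContinuousLinearMap.adjoint_inner_right, adjoint_perp]
    · rw [hMu, real_inner_comm, inner_perp_self]
      exact sq_nonneg _
  rw [perpLaw, charFun_multivariateGaussian_zero (hMp.smul (perpVariance_nonneg hS ht0 ht)),
    map_smul, LinearMap.smul_apply, hMu, real_inner_smul_right, inner_perp_self, mul_comm]

end Model

/-! ### The generative process and its two components -/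

section Solution

variable {Ω : Type*} {mΩ : MeasurableSpace Ω} {P : Measure Ω} {𝓕 : Filtration ℝ≥0 mΩ} {T : ℝ}
  {m k : ℕ} {g : ℝ → E m → E m} {G : ℝ → Matrix (Fin m) (Fin k) ℝ} {W : ℝ≥0 → Ω → E k}
  {X : ℝ≥0 → Ω → E m}

theorem IsSDESolution.measurable (hX : IsSDESolution P 𝓕 T g G W X) {t : ℝ≥0} (ht : (t : ℝ) < T) :
    Measurable (X t) :=
  (hX.adapted t ht).mono (𝓕.le t) le_rfl

theorem IsSDESolution.continuousOn_Icc (hX : IsSDESolution P 𝓕 T g G W X) {t : ℝ≥0}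
    (ht : (t : ℝ) < T) : ∀ᵐ ω ∂P, ContinuousOn (fun s => X s ω) (Icc 0 t) := by
  filter_upwards [hX.continuous_paths] with ω hω
  exact hω.mono fun s hs => lt_of_le_of_lt (NNReal.coe_le_coe.2 hs.2) ht

theorem IsSDESolution.ae_noisePart_map (hX : IsSDESolution P 𝓕 T g G W X) {n : ℕ}
    {g' : ℝ → E n → E n} (A : E m →L[ℝ] E n) (hg : ∀ x y, A (g x y) = g' x (A y)) {t : ℝ≥0}
    (ht : (t : ℝ) < T) : ∀ᵐ ω ∂P, ∀ s ≤ t,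
      A (noisePart g X s ω) = noisePart g' (fun t ω => A (X t ω)) s ω := by
  filter_upwards [hX.drift_integrable] with ω hω s hs
  exact noisePart_map A hg (hω s (lt_of_le_of_lt (NNReal.coe_le_coe.2 hs) ht))

end Solution

section Generation

variable {d r : ℕ} {α β ε : ℝ → ℝ} {T : ℝ} {σ p : ℝ → ℝ} {b : ℝ} {w : Matrix (Fin d) (Fin r) ℝ}
  {v : E r} {Ω : Type*} {mΩ : MeasurableSpace Ω} {P : Measure Ω} [IsProbabilityMeasure P]
  {𝓕 : Filtration ℝ≥0 mΩ} {W X : ℝ≥0 → Ω → E d}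

/-- A solution of the low-dimensional equation witnesses the integrability of its drift. -/
theorem IsSDESolution.admissibleDrift (hS : IsSchedule α β ε) (hT0 : 0 < T) (hT1 : T ≤ 1)
    (hα : ∀ t ∈ Ico 0 T, α t ≠ 0) (hp : Measurable p) (hσ : LocLipActivation T σ p v)
    {Q : Matrix (Fin r) (Fin r) ℝ} {G : ℝ → Matrix (Fin r) (Fin r) ℝ} {B Z : ℝ≥0 → Ω → E r}
    (hZ : IsSDESolution P 𝓕 T (lowDrift α β ε σ p b Q v) G B Z) {t : ℝ≥0} (ht : (t : ℝ) < T) :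
    AdmissibleDrift t (lowDrift α β ε σ p b Q v) := by
  obtain ⟨ω, hω, hω'⟩ := (hZ.drift_integrable.and (hZ.continuousOn_Icc ht)).exists
  refine admissibleDrift_lowDrift hS hT0 hT1 hα hp hσ Q ht
    (z := fun x => Z x.toNNReal ω) ?_ (hω t ht)
  refine hω'.comp continuous_real_toNNReal.continuousOn fun x hx => ?_
  exact ⟨zero_le, Real.toNNReal_le_iff_le_coe.2 hx.2⟩

theorem charFun_initial {Ω : Type*} {mΩ : MeasurableSpace Ω} {P : Measure Ω}
    {X : ℝ≥0 → Ω → E d} (hX0 : HasLaw (X 0) (multivariateGaussian 0 1) P) (u : E d) :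
    charFun (P.map (X 0)) u = Complex.exp ((-(‖u‖ ^ 2 / 2) : ℝ)) := by
  have := charFun_multivariateGaussian_smul_one (n := d) zero_le_one u
  rw [one_smul, mul_one] at this
  rw [hX0.map_eq, this]

theorem hasLaw_hiddenProj_initial (hX0 : HasLaw (X 0) (multivariateGaussian 0 1) P) :
    HasLaw (fun ω => hiddenProj w (X 0 ω)) (multivariateGaussian 0 (overlap w)) P := by
  refine hasLaw_of_charFun_eq (X := fun ω => hiddenCLM w (X 0 ω))
    ((hiddenCLM w).continuous.measurable.comp_aemeasurable hX0.aemeasurable) fun u => ?_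
  rw [charFun_map_clm _ hX0.aemeasurable, charFun_initial hX0, charFun_overlap]

theorem gaussianIncrements_gen (hS : IsSchedule α β ε) (hT1 : T ≤ 1)
    (hX : IsSDESolution P 𝓕 T (genDrift α β ε σ p b w v) (genDiffusion d ε) W X)
    (hX0 : HasLaw (X 0) (multivariateGaussian 0 1) P) {t : ℝ≥0} (ht : (t : ℝ) < T) :
    GaussianIncrements P t ε (fun u => ‖u‖ ^ 2) (noisePart (genDrift α β ε σ p b w v) X) := by
  have h1 (u : E d) : Matrix.toEuclideanLin (1 : Matrix (Fin d) (Fin d) ℝ).transpose u = u := by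
    simp
  have := IsSDESolution.gaussianIncrements (S := 1) hX
    (fun u => by rw [h1, charFun_initial hX0]) ht (hS.continuousOn_ε hT1 ht)
    fun x hx => hS.ε_nonneg x ⟨hx.1, hx.2.trans (ht.le.trans hT1)⟩
  simpa only [h1] using this

theorem gaussianIncrements_low (hS : IsSchedule α β ε) (hT1 : T ≤ 1) {B Z : ℝ≥0 → Ω → E r}
    (hZ : IsSDESolution P 𝓕 T (lowDrift α β ε σ p b (overlap w) v) (lowDiffusion ε (overlap w)) B Z)
    (hZ0 : HasLaw (Z 0) (multivariateGaussian 0 (overlap w)) P) {t : ℝ≥0} (ht : (t : ℝ) < T) :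
    GaussianIncrements P t ε (fun u => ‖ContinuousLinearMap.adjoint (hiddenCLM w) u‖ ^ 2)
      (noisePart (lowDrift α β ε σ p b (overlap w) v) Z) := by
  have := IsSDESolution.gaussianIncrements (S := CFC.sqrt (overlap w)) hZ
    (fun u => by rw [norm_sq_sqrt_overlap, hZ0.map_eq, charFun_overlap]) ht
    (hS.continuousOn_ε hT1 ht)
    fun x hx => hS.ε_nonneg x ⟨hx.1, hx.2.trans (ht.le.trans hT1)⟩
  simpa only [norm_sq_sqrt_overlap] using this

theorem hiddenCLM_genDiffusion {A : E d →L[ℝ] E r}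
    (hA : ∀ x, Matrix.toEuclideanLin (CFC.sqrt (overlap w)) (A x) = hiddenProj w x) (x : ℝ)
    (y : E d) : hiddenCLM w (Matrix.toEuclideanLin (genDiffusion d ε x) y)
      = Matrix.toEuclideanLin (lowDiffusion ε (overlap w) x) (A y) := by
  rw [genDiffusion, lowDiffusion, map_smul, map_smul, LinearMap.smul_apply, LinearMap.smul_apply,
    hA, map_smul]
  simp [hiddenCLM_apply]

/-- The auxiliary Wiener process consists of `r` copies of one coordinate of `W`, on a power of the
original space; `0 < d` provides that coordinate. -/
theorem exists_isSDESolution_extension (hd : 0 < d)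
    (hX : IsSDESolution P 𝓕 T (genDrift α β ε σ p b w v) (genDiffusion d ε) W X) :
    ∃ B : ℝ≥0 → Ω × (Fin r → Ω) → E r,
      IsSDESolution (P.prod (Measure.pi fun _ : Fin r => P))
        (prodFiltration 𝓕 (piFiltration (Fin r) 𝓕)) T
        (lowDrift α β ε σ p b (overlap w) v) (lowDiffusion ε (overlap w)) B
        (fun t ω => hiddenProj w (X t ω.1)) := by
  obtain ⟨A, C, hA, hC, hAC⟩ := exists_polar_factor w
  refine ⟨_, hX.map (π := Prod.fst) measurePreserving_fst (fun t => ?_)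
    (hX.wiener.prod_add (hX.wiener.pi ⟨0, hd⟩) A C hAC) (hiddenCLM w)
    (hiddenCLM_genDrift w) fun x s t ω => ?_⟩
  · exact @measurable_fst _ _ (𝓕 t) (piFiltration (Fin r) 𝓕 t)
  -- The auxiliary noise does not enter the equation because `𝒬^{1/2} C = 0`.
  · rw [hiddenCLM_genDiffusion hA, map_sub, add_sub_add_comm, ← map_sub C, map_add, map_sub,
      left_eq_add, lowDiffusion, map_smul, LinearMap.smul_apply, hC, smul_zero]

theorem exists_isSDESolution_of_linearIndependent (hd : 0 < d)
    (hX : IsSDESolution P 𝓕 T (genDrift α β ε σ p b w v) (genDiffusion d ε) W X)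
    (hw : LinearIndependent ℝ w.col) :
    ∃ B : ℝ≥0 → Ω → E r, IsSDESolution P 𝓕 T
        (lowDrift α β ε σ p b (overlap w) v) (lowDiffusion ε (overlap w)) B
        (fun t ω => hiddenProj w (X t ω)) := by
  obtain ⟨A, hA, hA'⟩ := exists_coisometric_polar_factor w hd hw
  refine ⟨_, hX.map (π := id) (MeasurePreserving.id P) (fun t => measurable_id)
    (hX.wiener.comp_clm A hA') (hiddenCLM w) (hiddenCLM_genDrift w) fun x s t ω => ?_⟩
  rw [hiddenCLM_genDiffusion hA, map_sub]
  rfl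

theorem hasLaw_perp (hS : IsSchedule α β ε) (hT1 : T ≤ 1) (hα : ∀ t ∈ Ico 0 T, α t ≠ 0)
    (hX : IsSDESolution P 𝓕 T (genDrift α β ε σ p b w v) (genDiffusion d ε) W X)
    (hX0 : HasLaw (X 0) (multivariateGaussian 0 1) P) {t : ℝ≥0} (ht : (t : ℝ) < T) :
    HasLaw (fun ω => perp w (X t ω)) (perpLaw α β ε b w t) P := by
  have hm : Measurable fun ω => perp w (X t ω) :=
    (perp w).continuous.measurable.comp (hX.measurable ht)
  have : IsFiniteMeasure (perpLaw α β ε b w t) := by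
    rw [perpLaw]
    infer_instance
  refine hasLaw_of_charFun_eq hm.aemeasurable fun u => ?_
  rw [charFun_perpLaw w hS t.coe_nonneg (ht.le.trans hT1), charFun_apply,
    integral_map hm.aemeasurable (by fun_prop), perpVariance]
  have hGI := (gaussianIncrements_gen hS hT1 hX hX0 ht).map (perp w)
  rw [adjoint_perp] at hGI
  refine hGI.integral_exp_of_linear (fun c u => ?_) (hS.continuousOn_ε hT1 ht)
    (hS.continuousOn_del hT1 hα ht) (Y := fun t ω => perp w (X t ω)) ?_
    (hX.ae_noisePart_map (perp w) (perp_genDrift w) ht) u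
  · rw [map_smul, norm_smul, mul_pow, Real.norm_eq_abs, sq_abs]
  · filter_upwards [hX.continuousOn_Icc ht] with ω hω
    exact (perp w).continuous.comp_continuousOn hω

theorem indepFun_perp_hiddenProj_Icc (hd : 0 < d) (hS : IsSchedule α β ε) (hT0 : 0 < T)
    (hT1 : T ≤ 1) (hα : ∀ t ∈ Ico 0 T, α t ≠ 0) (hp : Measurable p)
    (hX : IsSDESolution P 𝓕 T (genDrift α β ε σ p b w v) (genDiffusion d ε) W X)
    (hX0 : HasLaw (X 0) (multivariateGaussian 0 1) P) (hσ : LocLipActivation T σ p v) {t : ℝ≥0}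
    (ht : (t : ℝ) < T) :
    IndepFun (fun ω (s : Icc (0 : ℝ≥0) t) => perp w (X s ω))
      (fun ω (s : Icc (0 : ℝ≥0) t) => hiddenProj w (X s ω)) P := by
  have hsT : ∀ s ≤ t, (s : ℝ) < T := fun s hs => lt_of_le_of_lt (NNReal.coe_le_coe.2 hs) ht
  -- The extension serves only to certify that the drift of `Z` is admissible; independence is
  -- proved on the original space.
  obtain ⟨B, hB⟩ := exists_isSDESolution_extension hd hX
  refine indepFun_of_indepFun_noisePart
    (admissibleDrift_smul (hS.continuousOn_del (b := b) hT1 hα ht))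
    (hB.admissibleDrift hS hT0 hT1 hα hp hσ ht) (Y := fun t ω => perp w (X t ω))
    (Z := fun t ω => hiddenCLM w (X t ω))
    (fun s hs => (perp w).continuous.measurable.comp (hX.measurable (hsT s hs)))
    (fun s hs => (hiddenCLM w).continuous.measurable.comp (hX.measurable (hsT s hs))) ?_ ?_ ?_
  · filter_upwards [hX.continuousOn_Icc ht] with ω hω
    exact (perp w).continuous.comp_continuousOn hω
  · filter_upwards [hX.continuousOn_Icc ht] with ω hω
    exact (hiddenCLM w).continuous.comp_continuousOn hω
  · refine ((gaussianIncrements_gen hS hT1 hX hX0 ht).indepFun (perp w) (hiddenCLM w)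
      (norm_sq_perp_add_hidden w)).congr ?_ ?_
    · filter_upwards [hX.ae_noisePart_map (perp w) (perp_genDrift w) ht] with ω hω
      exact funext fun a => hω _ (ratTime_le t a)
    · filter_upwards [hX.ae_noisePart_map (hiddenCLM w) (hiddenCLM_genDrift w) ht] with ω hω
      exact funext fun a => hω _ (ratTime_le t a)

theorem indepFun_perp_hiddenProj (hd : 0 < d) (hS : IsSchedule α β ε) (hT0 : 0 < T)
    (hT1 : T ≤ 1) (hα : ∀ t ∈ Ico 0 T, α t ≠ 0) (hp : Measurable p)
    (hX : IsSDESolution P 𝓕 T (genDrift α β ε σ p b w v) (genDiffusion d ε) W X)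
    (hX0 : HasLaw (X 0) (multivariateGaussian 0 1) P) (hσ : LocLipActivation T σ p v) :
    IndepFun (fun ω (t : {t : ℝ≥0 // (t : ℝ) < T}) => perp w (X t ω))
      (fun ω (t : {t : ℝ≥0 // (t : ℝ) < T}) => hiddenProj w (X t ω)) P := by
  refine IndepFun.process_indepFun_process
    (fun s => (perp w).continuous.measurable.comp (hX.measurable s.2))
    (fun s => (hiddenCLM w).continuous.measurable.comp (hX.measurable s.2)) fun I J => ?_
  classical
  -- Finitely many times before `T` lie in one compact interval `[0, t]` with `t < T`. The empty
  -- supremum is `0`, whence the use of `0 < T`.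
  set t : ℝ≥0 := (I ∪ J).sup Subtype.val with htdef
  have ht : (t : ℝ) < T := by
    rw [← Real.lt_toNNReal_iff_coe_lt, htdef, Finset.sup_lt_iff (by simpa using hT0)]
    exact fun s _ => Real.lt_toNNReal_iff_coe_lt.2 s.2
  have hle : ∀ s ∈ I ∪ J, (s : ℝ≥0) ≤ t := fun s hs => Finset.le_sup (f := Subtype.val) hs
  have hI (i : I) : (i : ℝ≥0) ∈ Icc 0 t := ⟨zero_le, hle i (Finset.mem_union_left _ i.2)⟩
  have hJ (i : J) : (i : ℝ≥0) ∈ Icc 0 t := ⟨zero_le, hle i (Finset.mem_union_right _ i.2)⟩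
  exact (indepFun_perp_hiddenProj_Icc hd hS hT0 hT1 hα hp hX hX0 hσ ht).comp
    (φ := fun f (i : I) => f ⟨i, hI i⟩) (ψ := fun f (i : J) => f ⟨i, hJ i⟩)
    (measurable_pi_lambda _ fun i => measurable_pi_apply _)
    (measurable_pi_lambda _ fun i => measurable_pi_apply _)

/-- The noise parts of `hiddenProj w (X ·)` and `Z'` have the same law: both have covariance form
`‖hiddenCLM* u‖²` and the same `ε`. Uniqueness in law does the rest. -/
theorem map_hiddenProj_eq (hS : IsSchedule α β ε) (hT0 : 0 < T)
    (hT1 : T ≤ 1) (hα : ∀ t ∈ Ico 0 T, α t ≠ 0) (hp : Measurable p)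
    (hX : IsSDESolution P 𝓕 T (genDrift α β ε σ p b w v) (genDiffusion d ε) W X)
    (hX0 : HasLaw (X 0) (multivariateGaussian 0 1) P) (hσ : LocLipActivation T σ p v)
    {Ω' : Type*} {mΩ' : MeasurableSpace Ω'} {P' : Measure Ω'} [IsProbabilityMeasure P']
    {𝓕' : Filtration ℝ≥0 mΩ'} {B' Z' : ℝ≥0 → Ω' → E r}
    (hZ' : IsSDESolution P' 𝓕' T
      (lowDrift α β ε σ p b (overlap w) v) (lowDiffusion ε (overlap w)) B' Z')
    (hZ0' : HasLaw (Z' 0) (multivariateGaussian 0 (overlap w)) P') {t : ℝ≥0}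
    (ht : (t : ℝ) < T) : P.map (fun ω => hiddenProj w (X t ω)) = P'.map (Z' t) := by
  have hsT : ∀ s ≤ t, (s : ℝ) < T := fun s hs => lt_of_le_of_lt (NNReal.coe_le_coe.2 hs) ht
  refine map_eq_of_map_noisePart_eq (hZ'.admissibleDrift hS hT0 hT1 hα hp hσ ht)
    (Z := fun t ω => hiddenCLM w (X t ω))
    (fun s hs => (hiddenCLM w).continuous.measurable.comp (hX.measurable (hsT s hs)))
    (fun s hs => hZ'.measurable (hsT s hs)) ?_ (hZ'.continuousOn_Icc ht) ?_
  · filter_upwards [hX.continuousOn_Icc ht] with ω hω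
    exact (hiddenCLM w).continuous.comp_continuousOn hω
  · rw [← ((gaussianIncrements_gen hS hT1 hX hX0 ht).map (hiddenCLM w)).map_ratTime_eq
      (gaussianIncrements_low hS hT1 hZ' hZ0' ht)]
    refine Measure.map_congr ?_
    filter_upwards [hX.ae_noisePart_map (hiddenCLM w) (hiddenCLM_genDrift w) ht] with ω hω
    exact funext fun a => (hω _ (ratTime_le t a)).symm

theorem map_eq_conv_perpLaw (hd : 0 < d) (hS : IsSchedule α β ε) (hT0 : 0 < T)
    (hT1 : T ≤ 1) (hα : ∀ t ∈ Ico 0 T, α t ≠ 0) (hp : Measurable p)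
    (hX : IsSDESolution P 𝓕 T (genDrift α β ε σ p b w v) (genDiffusion d ε) W X)
    (hX0 : HasLaw (X 0) (multivariateGaussian 0 1) P) (hσ : LocLipActivation T σ p v)
    {L : E r →L[ℝ] E d} (hL : ∀ x, L (hiddenProj w x) = (colSpace w).starProjection x) {t : ℝ≥0}
    (ht : (t : ℝ) < T) :
    P.map (X t) = (P.map fun ω => hiddenProj w (X t ω)).map L ∗ perpLaw α β ε b w t := by
  have hZm : Measurable fun ω => hiddenProj w (X t ω) :=
    (hiddenCLM w).continuous.measurable.comp (hX.measurable ht)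
  have hYm : Measurable fun ω => perp w (X t ω) :=
    (perp w).continuous.measurable.comp (hX.measurable ht)
  have hLm : Measurable L := L.continuous.measurable
  have hZY : IndepFun (fun ω => hiddenProj w (X t ω)) (fun ω => perp w (X t ω)) P :=
    (indepFun_perp_hiddenProj hd hS hT0 hT1 hα hp hX hX0 hσ).symm.comp
      (φ := fun f : {t : ℝ≥0 // (t : ℝ) < T} → E r => f ⟨t, ht⟩)
      (ψ := fun f : {t : ℝ≥0 // (t : ℝ) < T} → E d => f ⟨t, ht⟩)
      (measurable_pi_apply _) (measurable_pi_apply _)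
  have hind : IndepFun (fun ω => L (hiddenProj w (X t ω))) (fun ω => perp w (X t ω)) P :=
    hZY.comp hLm measurable_id
  -- Orthogonal decomposition of `X t`, with the component in the column space recovered from `Z` by
  -- `L`.
  have hadd : X t = (fun ω => L (hiddenProj w (X t ω))) + fun ω => perp w (X t ω) := by
    ext1 ω
    rw [Pi.add_apply, hL]
    exact (Submodule.starProjection_add_starProjection_orthogonal _).symm
  rw [Measure.map_map hLm hZm, ← (hasLaw_perp hS hT1 hα hX hX0 ht).map_eq]
  conv_lhs => rw [hadd]
  exact hind.map_add_eq_map_conv_map₀ (hLm.comp hZm).aemeasurable hYm.aemeasurable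

end Generation

end GenDyn

open GenDyn

theorem mainTheorem1
    {d r : ℕ} (hd : 0 < d)
    -- schedules, and a time horizon before which `α` does not vanish
    (α β ε : ℝ → ℝ) (hS : IsSchedule α β ε)
    (T : ℝ) (hT0 : 0 < T) (hT1 : T ≤ 1) (hα : ∀ t ∈ Ico 0 T, α t ≠ 0)
    -- activation, time encoding and trained parameters
    (σ p : ℝ → ℝ) (hp : Measurable p)
    (b : ℝ) (w : Matrix (Fin d) (Fin r) ℝ) (v : E r)
    -- the generative process
    {Ω : Type u} {mΩ : MeasurableSpace Ω} (P : Measure Ω) [IsProbabilityMeasure P]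
    (𝓕 : Filtration ℝ≥0 mΩ) (W X : ℝ≥0 → Ω → E d)
    (hX : IsSDESolution P 𝓕 T (genDrift α β ε σ p b w v) (genDiffusion d ε) W X)
    (hX0 : HasLaw (X 0) (multivariateGaussian 0 1) P) :
    -- initial law of `Z`
    HasLaw (fun ω => hiddenProj w (X 0 ω)) (multivariateGaussian 0 (overlap w)) P ∧
    -- `Z` solves the low-dimensional SDE, on a product extension of the probability space
    (∃ (Ω₂ : Type u) (_ : MeasurableSpace Ω₂) (P₂ : Measure Ω₂) (_ : IsProbabilityMeasure P₂)
      (𝓖 : Filtration ℝ≥0 (inferInstance : MeasurableSpace (Ω × Ω₂)))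
      (B : ℝ≥0 → Ω × Ω₂ → E r),
      IsSDESolution (P.prod P₂) 𝓖 T
        (lowDrift α β ε σ p b (overlap w) v) (lowDiffusion ε (overlap w)) B
        (fun t ω => hiddenProj w (X t ω.1))) ∧
    -- no extension is needed if the columns of `w` are linearly independent
    (LinearIndependent ℝ w.col → ∃ B : ℝ≥0 → Ω → E r,
      IsSDESolution P 𝓕 T
        (lowDrift α β ε σ p b (overlap w) v) (lowDiffusion ε (overlap w)) B
        (fun t ω => hiddenProj w (X t ω))) ∧
    -- law of `Y`
    (∀ t : ℝ≥0, (t : ℝ) < T → HasLaw (fun ω => perp w (X t ω)) (perpLaw α β ε b w t) P) ∧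
    -- independence of the processes `Y` and `Z`
    (LocLipActivation T σ p v →
      IndepFun (fun ω (t : {t : ℝ≥0 // (t : ℝ) < T}) => perp w (X t ω))
        (fun ω (t : {t : ℝ≥0 // (t : ℝ) < T}) => hiddenProj w (X t ω)) P) ∧
    -- the low-dimensional SDE and the law of `Y` determine the law of `X`
    (∃ L : E r →L[ℝ] E d, (∀ x, L (hiddenProj w x) = (colSpace w).starProjection x) ∧
      (LocLipActivation T σ p v →
        ∀ (Ω' : Type v) (mΩ' : MeasurableSpace Ω') (P' : Measure Ω') (_ : IsProbabilityMeasure P')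
          (𝓕' : Filtration ℝ≥0 mΩ') (B' Z' : ℝ≥0 → Ω' → E r),
          IsSDESolution P' 𝓕' T
            (lowDrift α β ε σ p b (overlap w) v) (lowDiffusion ε (overlap w)) B' Z' →
          HasLaw (Z' 0) (multivariateGaussian 0 (overlap w)) P' →
          ∀ t : ℝ≥0, (t : ℝ) < T →
            P.map (X t) = (P'.map (Z' t)).map L ∗ perpLaw α β ε b w t)) := by
  obtain ⟨L, hL⟩ := exists_lift_hiddenProj w hd
  obtain ⟨B, hB⟩ := exists_isSDESolution_extension hd hX
  refine ⟨hasLaw_hiddenProj_initial hX0,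
    ⟨Fin r → Ω, _, _, inferInstance, _, B, hB⟩,
    exists_isSDESolution_of_linearIndependent hd hX,
    fun t ht => hasLaw_perp hS hT1 hα hX hX0 ht,
    indepFun_perp_hiddenProj hd hS hT0 hT1 hα hp hX hX0,
    L, hL, fun hσ Ω' mΩ' P' hP' 𝓕' B' Z' hZ' hZ0' t ht => ?_⟩
  rw [← map_hiddenProj_eq hS hT0 hT1 hα hp hX hX0 hσ hZ' hZ0' ht]
  exact map_eq_conv_perpLaw hd hS hT0 hT1 hα hp hX hX0 hσ hL ht
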